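/- Let $A=(A_m)_{m\ge 0}$ be an Appell sequence of real polynomials, i.e. $A_0=1$ and $A_m'=mA_{m-1}$ for $m\ge1$. Define $c_1,c_2,\dots$ by $\log\bigl(\sum_{k\ge0}A_k(0)\frac{t^k}{k!}\bigr)=\sum_{k\ge1}c_k\frac{t^k}{k!}$. For a partition $\lambda=(\lambda_1\ge\dots\ge\lambda_r>0)$ put $(n_1,n_2,\dots,n_r)=(\lambda_r,\lambda_{r-1}+1,\dots,\lambda_1+r-1)$ and let $$A_\lambda=\frac{\operatorname{Wr}[A_{n_1},\dots,A_{n_r}]}{\prod_{1\le i<j\le r}(n_j-n_i)}$$ be the associated Wronskian Appell polynomial ($A_\emptyset=1$). Let $F_\lambda$ be the number of standard Young tableaux of shape $\lambda$, and let $\mathbb{E}(\,\cdot:\lambda\vdash n)$ and $\operatorname{Var}(\,\cdot:\lambda\vdash n)$ denote expected value and variance with respect to the Plancherel measure $\lambda\mapsto F_\lambda^2/n!$ on the partitions of $n$. Then there is a central Appell sequence $B=(B_n)_{n\ge0}$ (central means $B_1(0)=0$) with $$\log\Bigl(\sum_{k\ge0}B_k(0)\frac{t^k}{k!}\Bigr)=\sum_{k\ge2}\frac{c_k^2}{(k-1)!}\frac{t^k}{k!}$$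 (it is determined by this equation) such that for all $n\ge2$ and all real $x$ $$\operatorname{Var}\bigl(A_\lambda(x):\lambda\vdash n\bigr)=\mathbb{E}\bigl(A_\lambda(x)^2:\lambda\vdash n\bigr)-\mathbb{E}\bigl(A_\lambda(x):\lambda\vdash n\bigr)^2=B_n\bigl((x+c_1)^2\bigr)-(x+c_1)^{2n},$$ and, for each $n\ge2$, $\operatorname{Var}\bigl(A_\lambda(x):\lambda\vdash n\bigr)=O(x^{2n-4})$ as $|x|\to\infty$. -/

import Mathlib

open Polynomial
open scoped Nat PowerSeries

noncomputable section

namespace WronskianAppell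

/-! ### Partitions and standard Young tableaux

A partition is identified with its Young diagram: `lam.rowLen i` is the `(i + 1)`-st part,
`lam.colLen 0` is the length and `lam.card` is the size. -/

/-- There are only finitely many partitions of `n`. -/
theorem finite_setOf_card_eq (n : ℕ) : {lam : YoungDiagram | lam.card = n}.Finite := by
  refine Set.Finite.of_finite_image
    (f := YoungDiagram.cells)
    (Set.Finite.subset (Finset.finite_toSet (Finset.range n ×ˢ Finset.range n).powerset) ?_)
    (fun a _ b _ h => YoungDiagram.ext h)
  rintro _ ⟨lam, rfl, rfl⟩
  simp only [Finset.mem_coe, Finset.mem_powerset]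
  rintro ⟨i, j⟩ hij
  have hrow : (Finset.range (j + 1)).image (fun k => (i, k)) ⊆ lam.cells := by
    intro c hc
    obtain ⟨k, hk, rfl⟩ := Finset.mem_image.1 hc
    exact lam.up_left_mem le_rfl (Nat.lt_succ_iff.1 (Finset.mem_range.1 hk)) hij
  have hcol : (Finset.range (i + 1)).image (fun k => (k, j)) ⊆ lam.cells := by
    intro c hc
    obtain ⟨k, hk, rfl⟩ := Finset.mem_image.1 hc
    exact lam.up_left_mem (Nat.lt_succ_iff.1 (Finset.mem_range.1 hk)) le_rfl hij
  have h1 := Finset.card_le_card hrow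
  have h2 := Finset.card_le_card hcol
  rw [Finset.card_image_of_injective _ (fun a b h => by simpa using h), Finset.card_range] at h1 h2
  simp only [Finset.mem_product, Finset.mem_range]
  exact ⟨h2, h1⟩

/-- The finite set of all partitions of `n`. -/
def partitionsOf (n : ℕ) : Finset YoungDiagram := (finite_setOf_card_eq n).toFinset

theorem mem_partitionsOf {n : ℕ} {lam : YoungDiagram} :
    lam ∈ partitionsOf n ↔ lam.card = n := by
  simp [partitionsOf]

/-- The standard Young tableaux of shape `lam`: the maximal saturated chains
`∅ = ν 0 ⋖ ν 1 ⋖ ⋯ ⋖ ν |lam| = lam` in Young's lattice. -/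
def standardTableaux (lam : YoungDiagram) : Set (Fin (lam.card + 1) → YoungDiagram) :=
  {ν | ν 0 = ⊥ ∧ ν (Fin.last lam.card) = lam ∧ ∀ i : Fin lam.card, ν i.castSucc ⋖ ν i.succ}

/-- `F lam`, the number of standard Young tableaux of shape `lam`. -/
def numSYT (lam : YoungDiagram) : ℕ := Nat.card (standardTableaux lam)

/-! ### Plancherel measure -/

/-- The expected value of `Y` with respect to the Plancherel measure on the partitions of `n`,
which gives `lam` the weight `(F lam) ^ 2 / n!`. -/
def plancherelExp (n : ℕ) (Y : YoungDiagram → ℝ) : ℝ :=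
  ∑ lam ∈ partitionsOf n, (numSYT lam : ℝ) ^ 2 / (n ! : ℝ) * Y lam

/-- The variance of `Y` with respect to the Plancherel measure on the partitions of `n`:
the expected squared deviation from the expected value. -/
def plancherelVar (n : ℕ) (Y : YoungDiagram → ℝ) : ℝ :=
  plancherelExp n (fun lam => (Y lam - plancherelExp n Y) ^ 2)

/-! ### Appell sequences and their cumulants -/

/-- Appell sequences of real polynomials: `A 0 = 1` and `(A n)' = n • A (n - 1)` for `n ≥ 1`. -/
def IsAppell (A : ℕ → ℝ[X]) : Prop :=
  A 0 = 1 ∧ ∀ n : ℕ, derivative (A (n + 1)) = ((n + 1 : ℕ) : ℝ[X]) * A n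

/-- The exponential generating function `f_A` of the constant terms `A n (0)`. -/
def constEGF (A : ℕ → ℝ[X]) : ℝ⟦X⟧ := PowerSeries.mk fun n => (A n).eval 0 / (n ! : ℝ)

/-- The numbers `c_k`, defined by `log f_A(t) = ∑ k ≥ 1, c_k t ^ k / k!`. -/
def cumulant (A : ℕ → ℝ[X]) (k : ℕ) : ℝ :=
  (k ! : ℝ) * PowerSeries.coeff k (PowerSeries.logOf (constEGF A))

/-! ### Wronskian Appell polynomials -/

/-- The Wronskian `det (fⱼ⁽ⁱ⁾)` of `r` polynomials. -/
def wronskianDet {r : ℕ} (f : Fin r → ℝ[X]) : ℝ[X] :=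
  (Matrix.of fun i j : Fin r => derivative^[(i : ℕ)] (f j)).det

/-- The degree vector `(lam_r, lam_{r-1} + 1, …, lam_1 + r - 1)` of a partition of length `r`. -/
def degreeVector (lam : YoungDiagram) (i : Fin (lam.colLen 0)) : ℕ :=
  lam.rowLen (i.rev : ℕ) + (i : ℕ)

/-- The Wronskian Appell polynomial `A_lam`: the Wronskian of the `A n` with `n` running through
the degree vector of `lam`, divided by the Vandermonde determinant of the degree vector. -/
def wronskianAppell (A : ℕ → ℝ[X]) (lam : YoungDiagram) : ℝ[X] :=
  C ((Matrix.vandermonde fun i => (degreeVector lam i : ℝ)).det)⁻¹ *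
    wronskianDet fun i => A (degreeVector lam i)

end WronskianAppell

end

/-! The polynomials `A_λ(x)` are normalized Schur functions. Specialize the complete homogeneous
functions to `h_k = A_k(x)/k!`; their generating function is `f_A(t) e^{xt}`, so Newton's identities
give the power sums `p_1 = x + c_1` and `p_k = c_k/(k-1)!` for `k ≥ 2`. The Wronskian is a
Jacobi-Trudi determinant `s_λ` up to a product of factorials, and the Vandermonde determinant is the
same product times `s_λ` at `h_k = 1/k!`. Writing `e_λ` for the latter value, `A_λ(x) = s_λ/e_λ`
(`IsAppell.eval_wronskianAppell`), while `F_λ = n! e_λ` (`numSYT_eq_schur`).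

The Plancherel weight is therefore `n! e_λ²`, so the mean is `n! ∑ e_λ s_λ` and the second moment is
`n! ∑ s_λ²`. By the Cauchy identity (`isNewton_sum_schur_mul`), such sums over `λ ⊢ n` again satisfy
Newton's identities, with the products `p_k p'_k` as power sums. For the mean only `k = 1` survives,
giving `(x + c_1)^n`; for the second moment the power sums are `p_k²`, which are those of `B` at `(x
+ c_1)²`. Since `B` is central, `B_n(y) - y^n` has degree at most `n - 2` in `y`, whence the growth
bound.

The Cauchy identity is proved on integer vectors of shifted parts. Lowering one entry by `k`, summed
over the entries, plays the role of `k ∂/∂p_k`; raising by `k` is multiplication by `p_k`; and the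
two are adjoint for the pairing that sums over all vectors. -/

namespace WronskianAppell

/-! ### Jacobi-Trudi determinants, Euler's identity and multiplication by power sums -/

section JacobiTrudi

variable {K : Type*} [Field K]

/-- The extension by zero to `ℤ` of a sequence. -/
def extendZero (h : ℕ → K) (m : ℤ) : K := if 0 ≤ m then h m.toNat else 0

theorem extendZero_of_neg (h : ℕ → K) {m : ℤ} (hm : m < 0) : extendZero h m = 0 :=
  if_neg (not_le.2 hm)

@[simp]
theorem extendZero_natCast (h : ℕ → K) (m : ℕ) : extendZero h m = h m := by
  simp [extendZero]

/-- The Jacobi-Trudi determinant `det (h (α j - i))`. -/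
noncomputable def jacobiTrudi (h : ℕ → K) {N : ℕ} (α : Fin N → ℤ) : K :=
  (Matrix.of fun i j : Fin N => extendZero h (α j - (i : ℕ))).det

/-- Newton's identities between `h` (complete homogeneous) and `p` (power sums). -/
def IsNewton (h p : ℕ → K) : Prop :=
  ∀ n : ℕ, (n : K) * h n = ∑ k ∈ Finset.Icc 1 n, p k * h (n - k)

theorem IsNewton.cast_mul_extendZero {h p : ℕ → K} (hp : IsNewton h p) {m : ℤ} {M : ℕ} (hm : m ≤ M) :
    (m : K) * extendZero h m = ∑ k ∈ Finset.Icc 1 M, p k * extendZero h (m - (k : ℕ)) := by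
  rcases lt_or_ge m 0 with h0 | h0
  · rw [extendZero_of_neg h h0, mul_zero, eq_comm]
    refine Finset.sum_eq_zero fun k _ => ?_
    rw [extendZero_of_neg h (by omega), mul_zero]
  · lift m to ℕ using h0
    rw [extendZero_natCast, Int.cast_natCast, hp m]
    have hsub : Finset.Icc 1 m ⊆ Finset.Icc 1 M := Finset.Icc_subset_Icc_right (by omega)
    rw [← Finset.sum_subset hsub]
    · refine Finset.sum_congr rfl fun k hk => ?_
      rw [Finset.mem_Icc] at hk
      rw [← Nat.cast_sub hk.2, extendZero_natCast]
    · intro k hk hk'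
      rw [Finset.mem_Icc] at hk hk'
      rw [extendZero_of_neg h (by omega), mul_zero]

/-- This is the first-order term in `ε` of `det((1 + ε diag d) V)`, expanded along columns. Through
cofactors it reduces to the diagonal entries of `V * adjugate V = det V • 1`. -/
theorem sum_det_updateCol_mul {n : Type*} [Fintype n] [DecidableEq n] (V : Matrix n n K)
    (d : n → K) :
    ∑ j, (V.updateCol j fun i => d i * V i j).det = (∑ i, d i) * V.det := by
  simp_rw [← Matrix.cramer_apply, Matrix.cramer_eq_adjugate_mulVec, Matrix.mulVec, dotProduct]
  rw [Finset.sum_comm, Finset.sum_mul]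
  refine Finset.sum_congr rfl fun i _ => ?_
  have h := congrFun (congrFun V.mul_adjugate i) i
  rw [Matrix.mul_apply, Matrix.smul_apply, Matrix.one_apply_eq, smul_eq_mul, mul_one] at h
  rw [← h, Finset.mul_sum]
  exact Finset.sum_congr rfl fun j _ => by ring

variable {N : ℕ}

theorem jacobiTrudi_update (h : ℕ → K) (α : Fin N → ℤ) (j : Fin N) (a : ℤ) :
    jacobiTrudi h (Function.update α j a) =
      ((Matrix.of fun i j : Fin N => extendZero h (α j - (i : ℕ))).updateCol j
        fun i => extendZero h (a - (i : ℕ))).det := by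
  unfold jacobiTrudi
  congr 1
  ext i l
  by_cases hl : l = j
  · subst hl; simp
  · simp [hl]

theorem jacobiTrudi_eq_zero_of_neg (h : ℕ → K) {α : Fin N → ℤ} {j : Fin N} (hj : α j < 0) :
    jacobiTrudi h α = 0 :=
  Matrix.det_eq_zero_of_column_eq_zero j fun i => extendZero_of_neg h (by omega)

theorem jacobiTrudi_eq_zero_of_eq (h : ℕ → K) {α : Fin N → ℤ} {i j : Fin N} (hij : i ≠ j)
    (he : α i = α j) : jacobiTrudi h α = 0 :=
  Matrix.det_zero_of_column_eq hij fun k => by simp [he]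

theorem jacobiTrudi_comp_perm (h : ℕ → K) (α : Fin N → ℤ) (σ : Equiv.Perm (Fin N)) :
    jacobiTrudi h (α ∘ σ) = ((Equiv.Perm.sign σ : ℤ) : K) * jacobiTrudi h α := by
  unfold jacobiTrudi
  rw [← Matrix.det_permute']
  rfl

/-- `shift α j a` adds `a` to the entry `α j`. -/
def shift (α : Fin N → ℤ) (j : Fin N) (a : ℤ) : Fin N → ℤ := Function.update α j (α j + a)

@[simp]
theorem shift_same (α : Fin N → ℤ) (j : Fin N) (a : ℤ) : shift α j a j = α j + a := by
  simp [shift]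

theorem shift_of_ne (α : Fin N → ℤ) {i j : Fin N} (a : ℤ) (h : i ≠ j) : shift α j a i = α i := by
  simp [shift, h]

theorem sum_shift (α : Fin N → ℤ) (j : Fin N) (a : ℤ) :
    ∑ i, shift α j a i = ∑ i, α i + a := by
  rw [shift, Finset.sum_update_of_mem (Finset.mem_univ j),
    ← Finset.add_sum_erase Finset.univ α (Finset.mem_univ j), Finset.sdiff_singleton_eq_erase]
  ring

theorem shift_shift_comm (α : Fin N → ℤ) (i j : Fin N) (a b : ℤ) :
    shift (shift α i a) j b = shift (shift α j b) i a := by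
  funext l
  by_cases hi : l = i <;> by_cases hj : l = j
  · subst hi hj; simp [add_right_comm]
  · subst hi; rw [shift_of_ne _ _ hj, shift_same, shift_same, shift_of_ne _ _ hj]
  · subst hj; rw [shift_of_ne _ _ hi, shift_same, shift_same, shift_of_ne _ _ hi]
  · simp only [shift_of_ne _ _ hi, shift_of_ne _ _ hj]

theorem shift_shift_same (α : Fin N → ℤ) (i : Fin N) (a b : ℤ) :
    shift (shift α i a) i b = shift α i (a + b) := by
  simp [shift, add_assoc]

@[simp]
theorem shift_zero (α : Fin N → ℤ) (i : Fin N) : shift α i 0 = α := by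
  simp [shift]

/-- Euler's identity: `|λ| s_λ = ∑ p_k (k ∂/∂p_k) s_λ`. -/
theorem IsNewton.sum_jacobiTrudi_shift_neg {h p : ℕ → K} (hp : IsNewton h p) (α : Fin N → ℤ)
    {M : ℕ} (hM : ∀ j, α j ≤ M) :
    ∑ k ∈ Finset.Icc 1 M, p k * ∑ j, jacobiTrudi h (shift α j (-(k : ℤ))) =
      ((∑ j, α j - ∑ i : Fin N, ((i : ℕ) : ℤ) : ℤ) : K) * jacobiTrudi h α := by
  set V : Matrix (Fin N) (Fin N) K := Matrix.of fun i j => extendZero h (α j - (i : ℕ)) with hV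
  have key : ∀ j, ∑ k ∈ Finset.Icc 1 M, p k * jacobiTrudi h (shift α j (-(k : ℤ))) =
      (α j : K) * V.det - (V.updateCol j fun i => ((i : ℕ) : K) * V i j).det := by
    intro j
    have e1 : ∀ k ∈ Finset.Icc 1 M, p k * jacobiTrudi h (shift α j (-(k : ℤ))) =
        V.cramer (p k • fun i : Fin N => extendZero h (α j + (-(k : ℤ)) - (i : ℕ))) j := by
      intro k _
      rw [map_smul, Pi.smul_apply, smul_eq_mul, Matrix.cramer_apply, shift, jacobiTrudi_update]
    rw [Finset.sum_congr rfl e1, ← Finset.sum_apply, ← map_sum]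
    -- Newton's identity at the index `α j - i` has the coefficient `α j - i`: a scalar on the
    -- column, minus a row weight `i` that is independent of `j`.
    have e2 : (∑ k ∈ Finset.Icc 1 M, p k • fun i : Fin N =>
        extendZero h (α j + (-(k : ℤ)) - (i : ℕ))) =
        (α j : K) • (fun i => V i j) - fun i : Fin N => ((i : ℕ) : K) * V i j := by
      funext i
      rw [Finset.sum_apply]
      have := hp.cast_mul_extendZero (m := α j - (i : ℕ)) (M := M) (by have := hM j; omega)
      simp only [Pi.smul_apply, smul_eq_mul, Pi.sub_apply, hV, Matrix.of_apply]
      rw [← sub_mul]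
      push_cast at this
      rw [this]
      exact Finset.sum_congr rfl fun k _ => by congr 2; ring
    rw [e2, map_sub, map_smul, Pi.sub_apply, Pi.smul_apply, Matrix.cramer_apply,
      Matrix.cramer_apply, smul_eq_mul]
    congr 2
    have : V.updateCol j (fun i => V i j) = V := by
      ext a b
      by_cases hb : b = j
      · subst hb; simp
      · simp [hb]
    rw [this]
  simp_rw [Finset.mul_sum]
  rw [Finset.sum_comm, Finset.sum_congr rfl fun j _ => key j, Finset.sum_sub_distrib,
    sum_det_updateCol_mul, ← Finset.sum_mul, ← sub_mul]
  push_cast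
  rw [hV, jacobiTrudi]

theorem sum_fin_le_sum {α : Fin N → ℤ} (h0 : ∀ i, 0 ≤ α i) (hα : Function.Injective α) :
    ∑ i : Fin N, ((i : ℕ) : ℤ) ≤ ∑ i, α i := by
  have h := Finset.sum_range_le_sum (s := Finset.univ.map ⟨α, hα⟩) (c := 0) (by simpa using h0)
  rw [Finset.sum_map, Finset.card_map, Finset.card_univ, Fintype.card_fin,
    ← Fin.sum_univ_eq_sum_range (fun i => 0 + (i : ℤ))] at h
  simpa using h

/-- Adjoining the missing value `v` gives `N + 1` distinct nonnegative integers, whose sum is at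
least `0 + ⋯ + N`. -/
theorem sum_fin_add_le_sum {α : Fin N → ℤ} (h0 : ∀ i, 0 ≤ α i) (hα : Function.Injective α)
    {v : ℕ} (hv : ∀ i, α i ≠ v) : ∑ i : Fin N, ((i : ℕ) : ℤ) + N ≤ ∑ i, α i + v := by
  have h := sum_fin_le_sum (N := N + 1) (α := Fin.cons (v : ℤ) α)
    (fun i => by refine Fin.cases ?_ (fun i => ?_) i <;> simp [h0])
    (Fin.cons_injective_iff.2 ⟨by simpa using hv, hα⟩)
  rw [Fin.sum_univ_castSucc, Fin.sum_univ_succ] at h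
  simp at h
  linarith

/-- Shifting any third entry keeps two columns equal; the two remaining terms differ by a
transposition of columns and cancel. -/
theorem sum_jacobiTrudi_shift_eq_zero (h : ℕ → K) {α : Fin N → ℤ} {a b : Fin N} (hab : a ≠ b)
    (he : α a = α b) (c : ℤ) : ∑ j, jacobiTrudi h (shift α j c) = 0 := by
  rw [← Finset.add_sum_erase _ _ (Finset.mem_univ a),
    ← Finset.add_sum_erase _ _ (Finset.mem_erase.2 ⟨hab.symm, Finset.mem_univ b⟩),
    Finset.sum_eq_zero, add_zero]
  · have : shift α b c = shift α a c ∘ Equiv.swap a b := by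
      funext i
      by_cases hia : i = a
      · subst hia; simp [shift, hab, hab.symm, he]
      by_cases hib : i = b
      · subst hib; simp [shift, he]
      · simp [shift, Equiv.swap_apply_of_ne_of_ne hia hib, hia, hib]
    rw [this, jacobiTrudi_comp_perm, Equiv.Perm.sign_swap hab]
    simp
  · intro j hj
    simp only [Finset.mem_erase] at hj
    exact jacobiTrudi_eq_zero_of_eq h hab
      (by rw [shift_of_ne _ _ hj.2.1.symm, shift_of_ne _ _ hj.1.symm, he])

/-- Multiplication by a power sum: `p_k s_λ` is a sum of signed `s_μ`, where `μ` runs through the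
partitions obtained from `λ` by adding a border strip of size `k`. -/
theorem IsNewton.sum_jacobiTrudi_shift [CharZero K] {h p : ℕ → K} (hp : IsNewton h p) {k : ℕ}
    (hk : 1 ≤ k) (α : Fin N → ℤ) (h0 : ∀ i, 0 ≤ α i) (hα : Function.Injective α)
    (hr : ∀ v : ℕ, v < k → ∃ i, α i = v) :
    ∑ j, jacobiTrudi h (shift α j k) = p k * jacobiTrudi h α := by
  obtain ⟨s, hs⟩ : ∃ s : ℕ, ∑ i, α i = s := ⟨_, (Int.toNat_of_nonneg
    (Finset.sum_nonneg fun i _ => h0 i)).symm⟩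
  -- Euler's identity applied to each raised vector reduces the formula to the lowered vectors,
  -- which have smaller sum.
  induction s using Nat.strong_induction_on generalizing α with
  | _ s ih =>
  have hle : ∀ i, α i ≤ s := fun i =>
    hs ▸ Finset.single_le_sum (fun j _ => h0 j) (Finset.mem_univ i)
  -- The extra term is the commutator `[k ∂/∂p_k, p_k] = k`: a lowering that makes an entry negative
  -- kills the determinant, yet raising the same entry by `k = l` restores `α`.
  have claim : ∀ l ∈ Finset.Icc 1 (s + k), ∀ i,
      ∑ j, jacobiTrudi h (shift (shift α i (-(l : ℤ))) j k) =
        p k * jacobiTrudi h (shift α i (-(l : ℤ))) +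
          if l = k then (if α i < k then jacobiTrudi h α else 0) else 0 := by
    intro l hl i
    rw [Finset.mem_Icc] at hl
    rcases lt_or_ge (α i - l) 0 with hneg | hnn
    · rw [jacobiTrudi_eq_zero_of_neg h (j := i) (by simp; omega), mul_zero, zero_add,
        Finset.sum_eq_single i, shift_shift_same]
      · by_cases hlk : l = k
        · subst hlk
          rw [if_pos rfl, if_pos (by omega)]
          simp
        · rw [if_neg hlk]
          rcases lt_or_ge (α i + (-(l : ℤ) + k)) 0 with hneg' | hnn'
          · exact jacobiTrudi_eq_zero_of_neg h (j := i) (by simpa using hneg')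
          -- Here `α i < l`, so the new value lies in `[0, k)`, where `hr` provides an entry; it is
          -- a different one because `l ≠ k`.
          · obtain ⟨i', hi'⟩ := hr (α i + (-(l : ℤ) + k)).toNat (by omega)
            rw [Int.toNat_of_nonneg hnn'] at hi'
            have hne : i' ≠ i := by rintro rfl; omega
            exact jacobiTrudi_eq_zero_of_eq h hne (by rw [shift_of_ne _ _ hne, shift_same, hi'])
      · intro j _ hj
        exact jacobiTrudi_eq_zero_of_neg h (j := i) (by
          rw [shift_of_ne _ _ hj.symm, shift_same]; omega)
      · simp
    · have hbr : (if l = k then (if α i < k then jacobiTrudi h α else 0) else 0) = 0 := by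
        split_ifs
        · omega
        · rfl
        · rfl
      rw [hbr, add_zero]
      by_cases hinj : Function.Injective (shift α i (-(l : ℤ)))
      -- If `α i < k`, the lowered value would already be taken by another entry. Hence entry `i` is
      -- not needed to fill `0, …, k - 1`, and `hr` passes to the lowered vector.
      · have hik : k ≤ α i := by
          by_contra hlt
          obtain ⟨i', hi'⟩ := hr (α i - l).toNat (by omega)
          rw [Int.toNat_of_nonneg hnn] at hi'
          have hne : i' ≠ i := by rintro rfl; omega
          exact hne (hinj (by rw [shift_of_ne _ _ hne, shift_same, hi']; ring))
        refine ih (s - l) ?_ _ ?_ hinj ?_ ?_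
        · have := hle i; omega
        · intro j
          by_cases hj : j = i
          · subst hj; simp; omega
          · rw [shift_of_ne _ _ hj]; exact h0 j
        · intro v hv
          obtain ⟨i', hi'⟩ := hr v hv
          have hne : i' ≠ i := by rintro rfl; omega
          exact ⟨i', by rw [shift_of_ne _ _ hne, hi']⟩
        · have := hle i
          rw [sum_shift, hs]; omega
      · obtain ⟨a, b, he, hab⟩ : ∃ a b, shift α i (-(l : ℤ)) a = shift α i (-(l : ℤ)) b ∧ a ≠ b := by
          simpa [Function.Injective] using hinj
        rw [sum_jacobiTrudi_shift_eq_zero h hab he, jacobiTrudi_eq_zero_of_eq h hab he, mul_zero]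
  -- The entries below `k` are exactly `0, …, k - 1`, so the commutator terms add up to the `k` in
  -- the factor `d + k`.
  have hcount : ((Finset.univ.filter fun i => α i < k).card : K) = k := by
    have : (Finset.univ.filter fun i => α i < k).map ⟨α, hα⟩ = Finset.Ico 0 (k : ℤ) := by
      ext v
      simp only [Finset.mem_map, Finset.mem_filter, Finset.mem_univ, true_and,
        Function.Embedding.coeFn_mk, Finset.mem_Ico]
      constructor
      · rintro ⟨i, hi, rfl⟩
        exact ⟨h0 i, hi⟩
      · rintro ⟨hv0, hv⟩
        lift v to ℕ using hv0
        obtain ⟨i, hi⟩ := hr v (by omega)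
        exact ⟨i, by omega, hi⟩
    rw [← Finset.card_map ⟨α, hα⟩, this]
    simp
  have hd0 := sum_fin_le_sum h0 hα
  set d : ℤ := ∑ i, α i - ∑ i : Fin N, ((i : ℕ) : ℤ) with hd
  have hsum : ∑ l ∈ Finset.Icc 1 (s + k), p l * ∑ j, jacobiTrudi h (shift α j (-(l : ℤ))) =
      (d : K) * jacobiTrudi h α :=
    hp.sum_jacobiTrudi_shift_neg α fun j => by have := hle j; push_cast; omega
  have hX : ((d + k : ℤ) : K) * ∑ j, jacobiTrudi h (shift α j k) =
      ∑ l ∈ Finset.Icc 1 (s + k), p l * ∑ i, ∑ j, jacobiTrudi h (shift (shift α i (-(l : ℤ))) j k) := by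
    have e : ∀ j, ((d + k : ℤ) : K) * jacobiTrudi h (shift α j k) =
        ∑ l ∈ Finset.Icc 1 (s + k), p l * ∑ i, jacobiTrudi h (shift (shift α i (-(l : ℤ))) j k) := by
      intro j
      have := hp.sum_jacobiTrudi_shift_neg (shift α j k) (M := s + k) (fun i => by
        by_cases hi : i = j
        · subst hi; have := hle i; simp; omega
        · rw [shift_of_ne _ _ hi]; have := hle i; push_cast; omega)
      rw [sum_shift] at this
      simp_rw [shift_shift_comm α j] at this
      rw [this, hd]
      congr 2
      ring
    rw [Finset.mul_sum, Finset.sum_congr rfl fun j _ => e j, Finset.sum_comm]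
    refine Finset.sum_congr rfl fun l _ => ?_
    rw [← Finset.mul_sum, Finset.sum_comm]
  have hfin : ((d + k : ℤ) : K) * ∑ j, jacobiTrudi h (shift α j k) =
      ((d + k : ℤ) : K) * (p k * jacobiTrudi h α) := by
    rw [hX, Finset.sum_congr rfl fun l hl => by
      rw [Finset.sum_congr rfl fun i _ => claim l hl i]]
    simp_rw [Finset.sum_add_distrib, mul_add]
    rw [Finset.sum_add_distrib]
    have e1 : ∑ l ∈ Finset.Icc 1 (s + k), p l * ∑ i, p k * jacobiTrudi h (shift α i (-(l : ℤ))) =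
        p k * ((d : K) * jacobiTrudi h α) := by
      rw [← hsum, Finset.mul_sum]
      refine Finset.sum_congr rfl fun l _ => ?_
      rw [← Finset.mul_sum]
      ring
    rw [e1, Finset.sum_eq_single k]
    · simp only [if_true]
      rw [← Finset.sum_filter, Finset.sum_const, nsmul_eq_mul, hcount]
      push_cast
      ring
    · intro l _ hl
      simp [hl]
    · intro hk'
      exact absurd (Finset.mem_Icc.2 ⟨hk, by omega⟩) hk'
  refine mul_left_cancel₀ ?_ hfin
  have : d + k ≠ 0 := by omega
  exact_mod_cast this

end JacobiTrudi

/-! ### The Cauchy identity as a recursion -/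

section Cauchy

variable {K : Type*} [Field K] {N : ℕ}

/-- The vectors of `N` nonnegative integers with sum `s`. -/
noncomputable def weightVectors (N : ℕ) (s : ℤ) : Finset (Fin N → ℤ) :=
  (Fintype.piFinset fun _ => Finset.Icc 0 s).filter fun α => ∑ i, α i = s

theorem mem_weightVectors {s : ℤ} {α : Fin N → ℤ} :
    α ∈ weightVectors N s ↔ (∀ i, 0 ≤ α i) ∧ ∑ i, α i = s := by
  simp only [weightVectors, Finset.mem_filter, Fintype.mem_piFinset, Finset.mem_Icc]
  refine ⟨fun h => ⟨fun i => (h.1 i).1, h.2⟩, fun h => ⟨fun i => ⟨h.1 i, ?_⟩, h.2⟩⟩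
  exact h.2 ▸ Finset.single_le_sum (fun j _ => h.1 j) (Finset.mem_univ i)

/-- Raising and lowering are adjoint: reindex by `β ↦ shift β j k`. The vectors `α` not reached have
a negative entry after lowering and contribute zero. -/
theorem sum_weightVectors_mul_shift_neg (h h' : ℕ → K) (s : ℤ) (k : ℕ) (j : Fin N) :
    ∑ α ∈ weightVectors N s, jacobiTrudi h (shift α j (-(k : ℤ))) * jacobiTrudi h' α =
      ∑ β ∈ weightVectors N (s - k), jacobiTrudi h β * jacobiTrudi h' (shift β j k) := by
  symm
  have hs : ∀ β : Fin N → ℤ, shift (shift β j k) j (-(k : ℤ)) = β := fun β => by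
    rw [shift_shift_same]; simp
  refine Finset.sum_of_injOn (fun β => shift β j k) ?_ ?_ ?_ ?_
  · intro β _ γ _ hβγ
    rw [← hs β, ← hs γ]
    exact congrArg (fun α => shift α j (-(k : ℤ))) hβγ
  · intro β hβ
    rw [Finset.mem_coe, mem_weightVectors] at hβ ⊢
    refine ⟨fun i => ?_, by rw [sum_shift, hβ.2]; ring⟩
    by_cases hi : i = j
    · subst hi; have := hβ.1 i; simp; omega
    · simp only [shift_of_ne _ _ hi]; exact hβ.1 i
  · intro α hα hα'
    rw [mem_weightVectors] at hα
    rw [jacobiTrudi_eq_zero_of_neg h (j := j), zero_mul]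
    by_contra hnn
    refine hα' ⟨shift α j (-(k : ℤ)), ?_, by simp [shift_shift_same]⟩
    rw [Finset.mem_coe, mem_weightVectors]
    refine ⟨fun i => ?_, by rw [sum_shift, hα.2]; ring⟩
    by_cases hi : i = j
    · subst hi; exact not_lt.1 hnn
    · rw [shift_of_ne _ _ hi]; exact hα.1 i
  · intro β _
    simp only [hs]

/-- Euler's identity expands the first factor, adjointness moves each shift to the second, and there
it becomes multiplication by `p' k`. The bound `n ≤ N` gives enough small entries for this last
step. -/
theorem cauchy_weightVectors [CharZero K] {h p h' p' : ℕ → K} (hp : IsNewton h p)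
    (hp' : IsNewton h' p') {n : ℕ} (hn : n ≤ N) :
    (n : K) * ∑ α ∈ weightVectors N (∑ i : Fin N, ((i : ℕ) : ℤ) + n),
        jacobiTrudi h α * jacobiTrudi h' α =
      ∑ k ∈ Finset.Icc 1 n, p k * p' k *
        ∑ α ∈ weightVectors N (∑ i : Fin N, ((i : ℕ) : ℤ) + (n - k : ℕ)),
          jacobiTrudi h α * jacobiTrudi h' α := by
  set T : ℕ := ∑ i : Fin N, (i : ℕ) with hT
  have hTc : ∑ i : Fin N, ((i : ℕ) : ℤ) = T := by rw [hT]; push_cast; rfl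
  rw [hTc]
  have hstep : ∀ k ∈ Finset.Icc 1 (T + n),
      p k * ∑ j, ∑ β ∈ weightVectors N ((T : ℤ) + n - k),
        jacobiTrudi h β * jacobiTrudi h' (shift β j k) =
      if k ≤ n then p k * p' k * ∑ β ∈ weightVectors N ((T : ℤ) + (n - k : ℕ)),
        jacobiTrudi h β * jacobiTrudi h' β else 0 := by
    intro k hk
    rw [Finset.mem_Icc] at hk
    rw [Finset.sum_comm]
    simp_rw [← Finset.mul_sum]
    split_ifs with hkn
    · rw [mul_assoc, Nat.cast_sub hkn, add_sub_assoc, Finset.mul_sum (a := p' k)]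
      congr 1
      refine Finset.sum_congr rfl fun β hβ => ?_
      rw [mem_weightVectors] at hβ
      by_cases hinj : Function.Injective β
      · rw [hp'.sum_jacobiTrudi_shift hk.1 β hβ.1 hinj]
        · ring
        · intro v hv
          -- A missing `v < k` would force the sum to be at least `T + N - v`, which exceeds `T + n
          -- - k`.
          by_contra! hne
          have := sum_fin_add_le_sum hβ.1 hinj hne
          rw [hTc, hβ.2] at this
          omega
      · obtain ⟨a, b, he, hab⟩ : ∃ a b, β a = β b ∧ a ≠ b := by
          simpa [Function.Injective] using hinj
        rw [jacobiTrudi_eq_zero_of_eq h hab he]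
        ring
    · rw [Finset.sum_eq_zero, mul_zero]
      intro β hβ
      rw [mem_weightVectors] at hβ
      by_cases hinj : Function.Injective β
      · have := sum_fin_le_sum hβ.1 hinj
        omega
      · obtain ⟨a, b, he, hab⟩ : ∃ a b, β a = β b ∧ a ≠ b := by
          simpa [Function.Injective] using hinj
        rw [jacobiTrudi_eq_zero_of_eq h hab he, zero_mul]
  calc (n : K) * ∑ α ∈ weightVectors N ((T : ℤ) + n), jacobiTrudi h α * jacobiTrudi h' α
      = ∑ α ∈ weightVectors N ((T : ℤ) + n), (∑ k ∈ Finset.Icc 1 (T + n),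
          p k * ∑ j, jacobiTrudi h (shift α j (-(k : ℤ)))) * jacobiTrudi h' α := by
        rw [Finset.mul_sum]
        refine Finset.sum_congr rfl fun α hα => ?_
        rw [mem_weightVectors] at hα
        rw [hp.sum_jacobiTrudi_shift_neg α fun j => ?_, hα.2, hTc]
        · push_cast
          ring
        · have := Finset.single_le_sum (fun j _ => hα.1 j) (Finset.mem_univ j)
          rw [hα.2] at this
          exact_mod_cast this
    _ = ∑ k ∈ Finset.Icc 1 (T + n), p k * ∑ j, ∑ α ∈ weightVectors N ((T : ℤ) + n),
          jacobiTrudi h (shift α j (-(k : ℤ))) * jacobiTrudi h' α := by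
        simp_rw [Finset.sum_mul]
        rw [Finset.sum_comm]
        refine Finset.sum_congr rfl fun k _ => ?_
        rw [Finset.sum_comm, Finset.mul_sum]
        refine Finset.sum_congr rfl fun α _ => ?_
        rw [mul_assoc, Finset.sum_mul]
    _ = _ := by
        simp_rw [sum_weightVectors_mul_shift_neg]
        rw [Finset.sum_congr rfl hstep, ← Finset.sum_filter]
        refine Finset.sum_congr ?_ fun _ _ => rfl
        ext k
        simp only [Finset.mem_filter, Finset.mem_Icc]
        omega

open scoped Classical in
-- Each injective vector is sorted by exactly one permutation, so its orbit has `N !` elements with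
-- one strictly increasing representative.
theorem sum_weightVectors_eq_factorial_mul (f : (Fin N → ℤ) → K)
    (hf : ∀ α (σ : Equiv.Perm (Fin N)), f (α ∘ σ) = f α)
    (hf0 : ∀ α, ¬ Function.Injective α → f α = 0) (s : ℤ) :
    ∑ α ∈ weightVectors N s, f α = N ! * ∑ α ∈ weightVectors N s with StrictMono α, f α := by
  have h1 : ∀ α, f α = ∑ σ : Equiv.Perm (Fin N), if StrictMono (α ∘ σ) then f (α ∘ σ) else 0 := by
    intro α
    by_cases hα : Function.Injective α
    · rw [Finset.sum_eq_single (Tuple.sort α), if_pos, hf]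
      · exact (Tuple.monotone_sort α).strictMono_of_injective
          (hα.comp (Tuple.sort α).injective)
      · intro σ _ hσ
        rw [if_neg]
        intro hmono
        refine hσ (Equiv.ext fun i => hα ?_)
        exact congrFun (Tuple.unique_monotone hmono.monotone (Tuple.monotone_sort α)) i
      · simp
    · rw [hf0 α hα, Finset.sum_eq_zero]
      intro σ _
      rw [if_neg]
      intro hmono
      exact hα ((Equiv.injective_comp σ α).1 hmono.injective)
  rw [Finset.sum_congr rfl fun α _ => h1 α, Finset.sum_comm]
  have h2 : ∀ σ : Equiv.Perm (Fin N),
      ∑ α ∈ weightVectors N s, (if StrictMono (α ∘ σ) then f (α ∘ σ) else 0) =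
        ∑ α ∈ weightVectors N s with StrictMono α, f α := by
    intro σ
    rw [Finset.sum_filter]
    refine Finset.sum_equiv (Equiv.arrowCongr σ.symm (Equiv.refl ℤ)) (fun α => ?_) fun α _ => ?_
    · simp only [mem_weightVectors, Equiv.arrowCongr_apply, Equiv.coe_refl, Equiv.symm_symm,
        Function.comp_apply, id]
      rw [Equiv.sum_comp σ α]
      exact and_congr_left fun _ => ⟨fun h i => h _, fun h i => by simpa using h (σ.symm i)⟩
    · rfl
  rw [Finset.sum_congr rfl fun σ _ => h2 σ, Finset.sum_const, nsmul_eq_mul, Finset.card_univ,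
    Fintype.card_perm, Fintype.card_fin]

open scoped Classical in
/-- The Cauchy identity, in the form of the recursion
`n Z_n = ∑ p_k p'_k Z_{n-k}` for `Z_n = ∑_{λ ⊢ n} s_λ s'_λ`. -/
theorem cauchy_strictMono [CharZero K] {h p h' p' : ℕ → K} (hp : IsNewton h p)
    (hp' : IsNewton h' p') {n : ℕ} (hn : n ≤ N) :
    (n : K) * ∑ α ∈ weightVectors N (∑ i : Fin N, ((i : ℕ) : ℤ) + n) with StrictMono α,
        jacobiTrudi h α * jacobiTrudi h' α =
      ∑ k ∈ Finset.Icc 1 n, p k * p' k *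
        ∑ α ∈ weightVectors N (∑ i : Fin N, ((i : ℕ) : ℤ) + (n - k : ℕ)) with StrictMono α,
          jacobiTrudi h α * jacobiTrudi h' α := by
  have key := cauchy_weightVectors hp hp' hn
  have hsym := sum_weightVectors_eq_factorial_mul (N := N)
    (fun α => jacobiTrudi h α * jacobiTrudi h' α)
    (fun α σ => by
      simp only [jacobiTrudi_comp_perm]
      rcases Int.units_eq_one_or (Equiv.Perm.sign σ) with hs | hs <;> simp [hs])
    (fun α hα => by
      obtain ⟨a, b, he, hab⟩ : ∃ a b, α a = α b ∧ a ≠ b := by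
        simpa [Function.Injective] using hα
      simp [jacobiTrudi_eq_zero_of_eq h hab he])
  simp_rw [hsym] at key
  refine mul_left_cancel₀ (a := (N ! : K)) (by exact_mod_cast N.factorial_ne_zero) ?_
  rw [mul_left_comm, key, Finset.mul_sum]
  exact Finset.sum_congr rfl fun k _ => by ring

end Cauchy

/-! ### Partitions as strictly increasing vectors of shifted parts -/

section Diagrams

theorem le_iff_rowLen_le {μ lam : YoungDiagram} : μ ≤ lam ↔ ∀ i, μ.rowLen i ≤ lam.rowLen i := by
  constructor
  · intro h i
    by_contra! hlt
    exact absurd (YoungDiagram.mem_iff_lt_rowLen.1 (h (YoungDiagram.mem_iff_lt_rowLen.2 hlt)))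
      (lt_irrefl _)
  · rintro h ⟨i, j⟩ hij
    exact YoungDiagram.mem_iff_lt_rowLen.2 ((YoungDiagram.mem_iff_lt_rowLen.1 hij).trans_le (h i))

theorem rowLen_eq_zero_iff {lam : YoungDiagram} {i : ℕ} : lam.rowLen i = 0 ↔ lam.colLen 0 ≤ i := by
  rw [← not_iff_not, ← Ne, ← Nat.pos_iff_ne_zero, ← YoungDiagram.mem_iff_lt_rowLen,
    YoungDiagram.mem_iff_lt_colLen, not_le]

theorem colLen_zero_le_card (lam : YoungDiagram) : lam.colLen 0 ≤ lam.card := by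
  rw [YoungDiagram.colLen_eq_card]
  exact Finset.card_le_card (Finset.filter_subset _ _)

theorem card_eq_sum_rowLen {lam : YoungDiagram} {N : ℕ} (hN : lam.colLen 0 ≤ N) :
    lam.card = ∑ i ∈ Finset.range N, lam.rowLen i := by
  simp_rw [YoungDiagram.rowLen_eq_card]
  refine Finset.card_eq_sum_card_fiberwise (f := Prod.fst) ?_
  rintro ⟨i, j⟩ hij
  rw [Finset.mem_coe, Finset.mem_range]
  by_contra! h
  have := YoungDiagram.mem_iff_lt_rowLen.1 hij
  rw [rowLen_eq_zero_iff.2 (hN.trans h)] at this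
  exact absurd this (Nat.not_lt_zero _)

theorem exists_rowLen_eq {r : ℕ → ℕ} (hr : Antitone r) {N : ℕ} (hN : ∀ i, N ≤ i → r i = 0) :
    ∃ lam : YoungDiagram, ∀ i, lam.rowLen i = r i := by
  have hmem : ∀ c : ℕ × ℕ, c ∈ (Finset.range N ×ˢ Finset.range (r 0)).filter
      (fun c => c.2 < r c.1) ↔ c.2 < r c.1 := by
    rintro ⟨i, j⟩
    simp only [Finset.mem_filter, Finset.mem_product, Finset.mem_range, and_iff_right_iff_imp]
    intro h
    refine ⟨?_, h.trans_le (hr (Nat.zero_le i))⟩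
    by_contra! hi
    rw [hN i hi] at h
    exact absurd h (Nat.not_lt_zero _)
  refine ⟨⟨(Finset.range N ×ˢ Finset.range (r 0)).filter fun c => c.2 < r c.1, ?_⟩, fun i => ?_⟩
  · rintro a b hba ha
    rw [Finset.mem_coe, hmem] at ha ⊢
    exact (hba.2.trans_lt ha).trans_le (hr hba.1)
  · refine eq_of_forall_lt_iff fun j => ?_
    rw [← YoungDiagram.mem_iff_lt_rowLen]
    exact hmem (i, j)

variable {N : ℕ}

/-- The shifted parts `lam_{N - j} + j`, for `j < N`, of a partition padded to length `N`. -/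
def betaVector (N : ℕ) (lam : YoungDiagram) (j : Fin N) : ℤ := lam.rowLen (j.rev : ℕ) + (j : ℕ)

theorem betaVector_nonneg (lam : YoungDiagram) (j : Fin N) : 0 ≤ betaVector N lam j := by
  unfold betaVector; positivity

theorem betaVector_strictMono (lam : YoungDiagram) : StrictMono (betaVector N lam) := by
  intro a b hab
  have h := lam.rowLen_anti b.rev a.rev (Fin.le_def.1 (Fin.rev_le_rev.2 hab.le))
  have : (a : ℕ) < b := hab
  unfold betaVector
  omega

theorem rowLen_eq_betaVector (lam : YoungDiagram) {i : ℕ} (hi : i < N) :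
    (lam.rowLen i : ℤ) = betaVector N lam (Fin.rev ⟨i, hi⟩) - (N - 1 - i : ℤ) := by
  unfold betaVector
  rw [Fin.rev_rev, Fin.val_rev]
  simp only
  omega

theorem le_iff_betaVector_le {μ lam : YoungDiagram} (hμ : μ.colLen 0 ≤ N) :
    μ ≤ lam ↔ ∀ j, betaVector N μ j ≤ betaVector N lam j := by
  rw [le_iff_rowLen_le]
  constructor
  · intro h j
    have := h j.rev
    unfold betaVector
    omega
  · intro h i
    by_cases hi : i < N
    · have := h (Fin.rev ⟨i, hi⟩)
      have h1 := rowLen_eq_betaVector μ hi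
      have h2 := rowLen_eq_betaVector lam hi
      omega
    · rw [rowLen_eq_zero_iff.2 (hμ.trans (not_lt.1 hi))]
      exact Nat.zero_le _

theorem betaVector_injective {μ lam : YoungDiagram} (hμ : μ.colLen 0 ≤ N) (hl : lam.colLen 0 ≤ N)
    (h : betaVector N μ = betaVector N lam) : μ = lam :=
  le_antisymm ((le_iff_betaVector_le hμ).2 fun j => (congrFun h j).le)
    ((le_iff_betaVector_le hl).2 fun j => (congrFun h j).ge)

theorem sum_betaVector {lam : YoungDiagram} (hl : lam.colLen 0 ≤ N) :
    ∑ j, betaVector N lam j = ∑ i : Fin N, ((i : ℕ) : ℤ) + lam.card := by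
  unfold betaVector
  rw [Finset.sum_add_distrib, add_comm, card_eq_sum_rowLen hl, ← Fin.sum_univ_eq_sum_range]
  congr 1
  push_cast
  exact Equiv.sum_comp Fin.revPerm fun i : Fin N => (lam.rowLen i : ℤ)

theorem add_sub_le_of_strictMono {α : Fin N → ℤ} (hα : StrictMono α) {a b : Fin N} (hab : a ≤ b) :
    α a + ((b : ℕ) - (a : ℕ) : ℤ) ≤ α b := by
  obtain ⟨b, hb⟩ := b
  induction b with
  | zero =>
    have : a = ⟨0, hb⟩ := le_antisymm hab (Fin.mk_le_of_le_val (Nat.zero_le _))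
    subst this
    simp
  | succ b ih =>
    rcases hab.eq_or_lt with h | h
    · subst h; simp
    · have h1 := ih (by omega) (by
        rw [Fin.lt_def] at h; rw [Fin.le_def]; simp only at h ⊢; omega)
      have h2 : α ⟨b, by omega⟩ < α ⟨b + 1, hb⟩ := hα (by rw [Fin.lt_def]; simp)
      push_cast at h1 ⊢
      omega

theorem exists_betaVector_eq {α : Fin N → ℤ} (hα : StrictMono α) (h0 : ∀ j, 0 ≤ α j) :
    ∃ lam : YoungDiagram, lam.colLen 0 ≤ N ∧ betaVector N lam = α := by
  have hge : ∀ j : Fin N, ((j : ℕ) : ℤ) ≤ α j := by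
    intro j
    have hN : 0 < N := j.pos
    have := add_sub_le_of_strictMono hα (a := ⟨0, hN⟩) (b := j) (Fin.mk_le_of_le_val (Nat.zero_le _))
    have := h0 ⟨0, hN⟩
    simp only [Nat.cast_zero] at *
    omega
  obtain ⟨lam, hlam⟩ := exists_rowLen_eq
    (r := fun i => if h : i < N then (α (Fin.rev ⟨i, h⟩) - (Fin.rev ⟨i, h⟩ : ℕ)).toNat else 0)
    (N := N) (by
      intro a b hab
      simp only
      by_cases hb : b < N
      · have ha : a < N := hab.trans_lt hb
        rw [dif_pos hb, dif_pos ha]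
        have := add_sub_le_of_strictMono hα (a := Fin.rev ⟨b, hb⟩) (b := Fin.rev ⟨a, ha⟩)
          (Fin.rev_le_rev.2 hab)
        omega
      · rw [dif_neg hb]
        exact Nat.zero_le _) (fun i hi => dif_neg (not_lt.2 hi))
  refine ⟨lam, ?_, ?_⟩
  · rw [← rowLen_eq_zero_iff, hlam, dif_neg (lt_irrefl N)]
  · funext j
    have := hge j
    unfold betaVector
    rw [hlam, dif_pos (j.rev).2]
    simp only [Fin.eta, Fin.rev_rev]
    omega

/-- Removing a box lowers one shifted part by one. -/
theorem covBy_iff_betaVector {μ lam : YoungDiagram} (hμ : μ.colLen 0 ≤ N)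
    (hl : lam.colLen 0 ≤ N) :
    μ ⋖ lam ↔ ∃ j, betaVector N μ = shift (betaVector N lam) j (-1) := by
  constructor
  · intro h
    have hle := (le_iff_betaVector_le hμ).1 h.lt.le
    have hex : (Finset.univ.filter fun j => betaVector N μ j < betaVector N lam j).Nonempty := by
      by_contra! hne
      refine h.lt.ne (betaVector_injective hμ hl (funext fun j => (hle j).antisymm ?_))
      by_contra! hlt
      exact Finset.notMem_empty j (hne ▸ Finset.mem_filter.2 ⟨Finset.mem_univ j, hlt⟩)
    -- At the least index where the vectors differ, lowering by one stays above `μ` and keeps the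
    -- vector strictly increasing. The result is a diagram in `[μ, lam)`, hence `μ` itself.
    obtain ⟨j, hj, hmin⟩ := Finset.exists_minimal hex
    rw [Finset.mem_filter] at hj
    have heq : ∀ i, i < j → betaVector N μ i = betaVector N lam i := by
      intro i hi
      refine (hle i).antisymm ?_
      by_contra! hlt
      exact absurd (hmin (Finset.mem_filter.2 ⟨Finset.mem_univ i, hlt⟩) hi.le) (not_le.2 hi)
    have hmono : StrictMono (shift (betaVector N lam) j (-1)) := by
      intro a b hab
      have h1 := betaVector_strictMono (N := N) lam hab
      by_cases hb : b = j
      · subst hb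
        have h2 := betaVector_strictMono (N := N) μ hab
        have h3 := heq a hab
        rw [shift_same, shift_of_ne _ _ hab.ne]
        omega
      · rw [shift_of_ne _ _ hb]
        by_cases ha : a = j
        · subst ha
          rw [shift_same]
          omega
        · rwa [shift_of_ne _ _ ha]
    have hnn : ∀ i, 0 ≤ shift (betaVector N lam) j (-1) i := by
      intro i
      by_cases hi : i = j
      · subst hi
        have := betaVector_nonneg μ i
        rw [shift_same]
        omega
      · rw [shift_of_ne _ _ hi]
        exact betaVector_nonneg lam i
    obtain ⟨ν, hν, hνe⟩ := exists_betaVector_eq hmono hnn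
    refine ⟨j, ?_⟩
    rw [← hνe]
    have h1 : μ ≤ ν := by
      rw [le_iff_betaVector_le hμ, hνe]
      intro i
      by_cases hi : i = j
      · subst hi; rw [shift_same]; omega
      · rw [shift_of_ne _ _ hi]; exact hle i
    have h2 : ν < lam := by
      refine lt_of_le_of_ne ((le_iff_betaVector_le hν).2 ?_) ?_
      · intro i
        rw [hνe]
        by_cases hi : i = j
        · subst hi; rw [shift_same]; omega
        · rw [shift_of_ne _ _ hi]
      · rintro rfl
        have := congrFun hνe j
        rw [shift_same] at this
        omega
    rw [(h.eq_or_eq h1 h2.le).resolve_right h2.ne]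
  · rintro ⟨j, hj⟩
    have hcard : lam.card = μ.card + 1 := by
      have h1 := sum_betaVector hμ
      rw [hj, sum_shift, sum_betaVector hl] at h1
      omega
    have hle : μ ≤ lam := by
      rw [le_iff_betaVector_le hμ, hj]
      intro i
      by_cases hi : i = j
      · subst hi; rw [shift_same]; omega
      · rw [shift_of_ne _ _ hi]
    refine ⟨lt_of_le_of_ne hle (by rintro rfl; omega), fun ν h1 h2 => ?_⟩
    have h3 := Finset.card_lt_card (YoungDiagram.cells_ssubset_iff.2 h1)
    have h4 := Finset.card_lt_card (YoungDiagram.cells_ssubset_iff.2 h2)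
    unfold YoungDiagram.card at hcard
    omega

theorem card_eq_of_covBy {μ lam : YoungDiagram} (h : μ ⋖ lam) : lam.card = μ.card + 1 := by
  have hN := le_max_left (μ.colLen 0) (lam.colLen 0)
  have hN' := le_max_right (μ.colLen 0) (lam.colLen 0)
  obtain ⟨j, hj⟩ := (covBy_iff_betaVector hN hN').1 h
  have h1 := sum_betaVector hN
  rw [hj, sum_shift, sum_betaVector hN'] at h1
  omega

theorem colLen_zero_le_of_mem_partitionsOf {lam : YoungDiagram} {n : ℕ}
    (h : lam ∈ partitionsOf n) : lam.colLen 0 ≤ n :=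
  mem_partitionsOf.1 h ▸ colLen_zero_le_card lam

open scoped Classical in
theorem sum_strictMono_eq_sum_partitionsOf {M : Type*} [AddCommMonoid M] (f : (Fin N → ℤ) → M)
    {n : ℕ} (hn : n ≤ N) :
    ∑ α ∈ weightVectors N (∑ i : Fin N, ((i : ℕ) : ℤ) + n) with StrictMono α, f α =
      ∑ lam ∈ partitionsOf n, f (betaVector N lam) := by
  symm
  refine Finset.sum_bij (fun lam _ => betaVector N lam) ?_ ?_ ?_ fun _ _ => rfl
  · intro lam hl
    have hc := (colLen_zero_le_of_mem_partitionsOf hl).trans hn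
    rw [Finset.mem_filter, mem_weightVectors, sum_betaVector hc, mem_partitionsOf.1 hl]
    exact ⟨⟨betaVector_nonneg lam, rfl⟩, betaVector_strictMono lam⟩
  · intro a ha b hb hab
    exact betaVector_injective ((colLen_zero_le_of_mem_partitionsOf ha).trans hn)
      ((colLen_zero_le_of_mem_partitionsOf hb).trans hn) hab
  · intro α hα
    rw [Finset.mem_filter, mem_weightVectors] at hα
    obtain ⟨lam, hl, rfl⟩ := exists_betaVector_eq hα.2 hα.1.1
    refine ⟨lam, ?_, rfl⟩
    rw [mem_partitionsOf]
    have := hα.1.2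
    rw [sum_betaVector hl] at this
    omega

variable {K : Type*} [Field K]

/-- Padding with an empty row prepends a `0` and adds one to the other shifted parts. The first
column becomes the first unit vector, and expanding along it recovers the smaller determinant. -/
theorem jacobiTrudi_betaVector_succ {h : ℕ → K} (h1 : h 0 = 1) {lam : YoungDiagram}
    (hl : lam.colLen 0 ≤ N) :
    jacobiTrudi h (betaVector (N + 1) lam) = jacobiTrudi h (betaVector N lam) := by
  have hz : betaVector (N + 1) lam 0 = 0 := by
    simp [betaVector, rowLen_eq_zero_iff, hl]
  have hs : ∀ j : Fin N, betaVector (N + 1) lam j.succ = betaVector N lam j + 1 := by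
    intro j
    simp only [betaVector, Fin.rev_succ, Fin.val_castSucc, Fin.val_succ]
    push_cast
    ring
  unfold jacobiTrudi
  rw [Matrix.det_succ_column_zero, Fin.sum_univ_succ, Finset.sum_eq_zero, add_zero]
  · simp only [Matrix.of_apply, hz, Fin.val_zero, pow_zero, one_mul]
    rw [Nat.cast_zero, sub_zero, ← Nat.cast_zero, extendZero_natCast, h1, one_mul]
    congr 1
    ext i j
    simp only [Matrix.submatrix_apply, Matrix.of_apply, Fin.zero_succAbove, hs, Fin.val_succ]
    congr 1
    push_cast
    ring
  · intro i _
    simp only [Matrix.of_apply, hz]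
    rw [extendZero_of_neg h (by simp; omega)]
    ring

theorem jacobiTrudi_betaVector_of_le {h : ℕ → K} (h1 : h 0 = 1) {lam : YoungDiagram} {M : ℕ}
    (hM : lam.colLen 0 ≤ M) (hMN : M ≤ N) :
    jacobiTrudi h (betaVector N lam) = jacobiTrudi h (betaVector M lam) := by
  induction N, hMN using Nat.le_induction with
  | base => rfl
  | succ N hN ih => rw [jacobiTrudi_betaVector_succ h1 (hM.trans hN), ih]

theorem colLen_bot : (⊥ : YoungDiagram).colLen 0 = 0 :=
  Nat.le_zero.1 ((colLen_zero_le_card ⊥).trans_eq (by simp))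

theorem jacobiTrudi_betaVector_bot {h : ℕ → K} (h1 : h 0 = 1) :
    jacobiTrudi h (betaVector N ⊥) = 1 := by
  rw [jacobiTrudi_betaVector_of_le h1 (M := 0) colLen_bot.le (Nat.zero_le N)]
  exact Matrix.det_isEmpty

theorem partitionsOf_zero : partitionsOf 0 = {⊥} := by
  ext lam
  rw [mem_partitionsOf, Finset.mem_singleton]
  constructor
  · intro h
    exact YoungDiagram.ext (by simpa using Finset.card_eq_zero.1 h)
  · rintro rfl
    simp

open scoped Classical in
-- A lowered vector that comes from no partition has a negative entry or two equal entries, so its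
-- determinant vanishes.
theorem sum_jacobiTrudi_shift_eq_sum_covBy (h : ℕ → K) {lam : YoungDiagram} {m : ℕ}
    (hm : lam.card = m + 1) (hN : m + 1 ≤ N) :
    ∑ j, jacobiTrudi h (shift (betaVector N lam) j (-1)) =
      ∑ μ ∈ partitionsOf m with μ ⋖ lam, jacobiTrudi h (betaVector N μ) := by
  have hl : lam.colLen 0 ≤ N := (colLen_zero_le_card lam).trans (by omega)
  have hμ : ∀ μ ∈ partitionsOf m, μ.colLen 0 ≤ N := fun μ h =>
    (colLen_zero_le_of_mem_partitionsOf h).trans (by omega)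
  have hinj : Function.Injective fun j => shift (betaVector N lam) j (-1) := by
    intro a b hab
    by_contra hne
    have := congrFun hab a
    simp only [shift_same, shift_of_ne _ _ hne] at this
    omega
  rw [← Finset.sum_image (g := fun j => shift (betaVector N lam) j (-1)) (f := jacobiTrudi h)
      (fun a _ b _ hab => hinj hab),
    ← Finset.sum_image (g := fun μ => betaVector N μ) (f := jacobiTrudi h)
      (fun a ha b hb hab => betaVector_injective (hμ a (Finset.mem_filter.1 ha).1)
        (hμ b (Finset.mem_filter.1 hb).1) hab)]
  symm
  refine Finset.sum_subset ?_ ?_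
  · intro v hv
    obtain ⟨μ, hm, rfl⟩ := Finset.mem_image.1 hv
    rw [Finset.mem_filter] at hm
    obtain ⟨j, hj⟩ := (covBy_iff_betaVector (hμ μ hm.1) hl).1 hm.2
    exact Finset.mem_image.2 ⟨j, Finset.mem_univ j, hj.symm⟩
  · intro v hv hv'
    obtain ⟨j, -, rfl⟩ := Finset.mem_image.1 hv
    by_contra hne
    refine hv' ?_
    have hnn : ∀ i, 0 ≤ shift (betaVector N lam) j (-1) i := by
      intro i
      by_contra! hlt
      exact hne (jacobiTrudi_eq_zero_of_neg h hlt)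
    have hmono : StrictMono (shift (betaVector N lam) j (-1)) := by
      intro a b hab
      refine lt_of_le_of_ne ?_ fun he => hne (jacobiTrudi_eq_zero_of_eq h hab.ne he)
      have h1 := betaVector_strictMono (N := N) lam hab
      by_cases hb : b = j
      · subst hb
        rw [shift_same, shift_of_ne _ _ hab.ne]
        omega
      · rw [shift_of_ne _ _ hb]
        by_cases ha : a = j
        · subst ha
          rw [shift_same]
          omega
        · rw [shift_of_ne _ _ ha]
          exact h1.le
    obtain ⟨μ, hμN, hμe⟩ := exists_betaVector_eq hmono hnn
    have hcov := (covBy_iff_betaVector hμN hl).2 ⟨j, hμe⟩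
    refine Finset.mem_image.2 ⟨μ, Finset.mem_filter.2 ⟨?_, hcov⟩, hμe⟩
    have := card_eq_of_covBy hcov
    rw [mem_partitionsOf]
    omega

/-! ### Counting standard Young tableaux -/

/-- The saturated chains of length `m` from `⊥` to `lam` in Young's lattice. -/
def saturatedChains (m : ℕ) (lam : YoungDiagram) : Set (Fin (m + 1) → YoungDiagram) :=
  {ν | ν 0 = ⊥ ∧ ν (Fin.last m) = lam ∧ ∀ i : Fin m, ν i.castSucc ⋖ ν i.succ}

theorem snoc_mem_saturatedChains {m : ℕ} {μ lam : YoungDiagram} (h : μ ⋖ lam)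
    {ν : Fin (m + 1) → YoungDiagram} (hν : ν ∈ saturatedChains m μ) :
    (Fin.snoc ν lam : Fin (m + 2) → YoungDiagram) ∈ saturatedChains (m + 1) lam := by
  refine ⟨?_, by simp, fun i => ?_⟩
  · rw [← Fin.castSucc_zero, Fin.snoc_castSucc, hν.1]
  · refine Fin.lastCases ?_ (fun i => ?_) i
    · rw [Fin.snoc_castSucc, Fin.succ_last, Fin.snoc_last, hν.2.1]
      exact h
    · rw [Fin.snoc_castSucc, Fin.succ_castSucc, Fin.snoc_castSucc]
      exact hν.2.2 i

/-- The index `μ` is the last entry of the chain, so the chain alone determines the pair. -/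
theorem sigma_saturatedChains_ext {m : ℕ} {S : Finset YoungDiagram}
    {p q : Σ μ : S, saturatedChains m (μ : YoungDiagram)} (h : p.2.1 = q.2.1) : p = q := by
  obtain ⟨⟨μ, hμ⟩, ⟨ν, h0, h1, h2⟩⟩ := p
  obtain ⟨⟨μ', hμ'⟩, ⟨ν', h0', h1', h2'⟩⟩ := q
  dsimp only at h
  subst h
  obtain rfl : μ = μ' := h1.symm.trans h1'
  rfl

/-- Removing the last step of a saturated chain. -/
def saturatedChainsSuccEquiv (m : ℕ) (lam : YoungDiagram) (S : Finset YoungDiagram)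
    (hS : ∀ μ, μ ∈ S ↔ μ ⋖ lam) :
    saturatedChains (m + 1) lam ≃ Σ μ : S, saturatedChains m (μ : YoungDiagram) where
  toFun ν := ⟨⟨ν.1 (Fin.last m).castSucc, (hS _).2 (by
      have := ν.2.2.2 (Fin.last m)
      rwa [Fin.succ_last, ν.2.2.1] at this)⟩,
    ⟨fun i => ν.1 i.castSucc, ν.2.1, rfl, fun i => ν.2.2.2 i.castSucc⟩⟩
  invFun p := ⟨Fin.snoc p.2.1 lam, snoc_mem_saturatedChains ((hS _).1 p.1.2) p.2.2⟩
  left_inv ν := by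
    refine Subtype.ext (funext fun i => ?_)
    refine Fin.lastCases ?_ (fun i => ?_) i
    · simp [ν.2.2.1]
    · simp
  right_inv p := sigma_saturatedChains_ext (funext fun i =>
    Fin.snoc_castSucc (α := fun _ => YoungDiagram) lam p.2.1 i)

open scoped Classical in
-- When `p 1 = 1` is the only nonzero power sum, Euler's identity says that the sum of `s_μ` over `μ
-- ⋖ lam` is `|lam| s_lam`. Up to the factorial, this is the recursion obtained by deleting the last
-- step of a chain.
theorem card_saturatedChains {h : ℕ → K} [CharZero K] (h1 : h 0 = 1)
    (hp : IsNewton h fun k => if k = 1 then 1 else 0) {m : ℕ} (hm : m ≤ N) {lam : YoungDiagram}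
    (hl : lam.card = m) :
    Finite (saturatedChains m lam) ∧
      (Nat.card (saturatedChains m lam) : K) = m ! * jacobiTrudi h (betaVector N lam) := by
  induction m generalizing lam with
  | zero =>
    have hbot : lam = ⊥ := by
      rw [← mem_partitionsOf, partitionsOf_zero, Finset.mem_singleton] at hl
      exact hl
    subst hbot
    have : saturatedChains 0 ⊥ = {fun _ => ⊥} := by
      ext ν
      rw [Set.mem_singleton_iff]
      constructor
      · intro hν
        funext i
        rw [Subsingleton.elim (α := Fin 1) i 0, hν.1]
      · rintro rfl
        exact ⟨rfl, rfl, fun i => i.elim0⟩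
    rw [this, jacobiTrudi_betaVector_bot h1]
    exact ⟨inferInstance, by simp⟩
  | succ m ih =>
    set S := (partitionsOf m).filter fun μ => μ ⋖ lam with hSdef
    have hS : ∀ μ, μ ∈ S ↔ μ ⋖ lam := by
      intro μ
      rw [hSdef, Finset.mem_filter, mem_partitionsOf, and_iff_right_iff_imp]
      intro hcov
      have := card_eq_of_covBy hcov
      omega
    have hi : ∀ μ : S, Finite (saturatedChains m (μ : YoungDiagram)) ∧
        (Nat.card (saturatedChains m (μ : YoungDiagram)) : K) =
          m ! * jacobiTrudi h (betaVector N μ) :=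
      fun μ => ih (by omega) (mem_partitionsOf.1 (Finset.mem_filter.1 μ.2).1)
    have hfin : ∀ μ : S, Finite (saturatedChains m (μ : YoungDiagram)) := fun μ => (hi μ).1
    have e := saturatedChainsSuccEquiv m lam S hS
    refine ⟨Finite.of_equiv _ e.symm, ?_⟩
    have hc : lam.colLen 0 ≤ N := (colLen_zero_le_card lam).trans (by omega)
    have hN1 : ∀ j, betaVector N lam j ≤ (∑ j, betaVector N lam j).toNat := by
      intro j
      have := Finset.single_le_sum (fun j _ => betaVector_nonneg lam j) (Finset.mem_univ j)
      omega
    have hE := hp.sum_jacobiTrudi_shift_neg (betaVector N lam) hN1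
    have hmem : 1 ∈ Finset.Icc 1 (∑ j, betaVector N lam j).toNat := by
      rw [Finset.mem_Icc, sum_betaVector hc]
      have : (0 : ℤ) ≤ ∑ i : Fin N, ((i : ℕ) : ℤ) := Finset.sum_nonneg fun i _ => by positivity
      omega
    rw [Finset.sum_eq_single 1 (fun k _ hk => by simp [hk]) (fun h => absurd hmem h), if_pos rfl,
      one_mul, Nat.cast_one, sum_jacobiTrudi_shift_eq_sum_covBy h hl hm, sum_betaVector hc,
      add_sub_cancel_left, hl, Int.cast_natCast] at hE
    rw [Nat.card_congr e, Nat.card_sigma, Nat.cast_sum, Finset.sum_congr rfl fun μ _ => (hi μ).2,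
      ← Finset.mul_sum, Finset.sum_coe_sort S fun μ => jacobiTrudi h (betaVector N μ), hE,
      Nat.factorial_succ]
    push_cast
    ring

theorem numSYT_eq {h : ℕ → K} [CharZero K] (h1 : h 0 = 1)
    (hp : IsNewton h fun k => if k = 1 then 1 else 0) {lam : YoungDiagram} (hN : lam.card ≤ N) :
    (numSYT lam : K) = lam.card ! * jacobiTrudi h (betaVector N lam) :=
  (card_saturatedChains h1 hp hN rfl).2

end Diagrams

/-! ### Schur functions and Newton's identities -/

section Newton

variable {K : Type*} [Field K]

/-- The Schur function of `lam`, where `h` is the sequence of values of the complete homogeneous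
symmetric functions. -/
noncomputable def schur (h : ℕ → K) (lam : YoungDiagram) : K :=
  jacobiTrudi h (betaVector (lam.colLen 0) lam)

/-- The Cauchy recursion at order `n` is used with `N = n`; stability under padding makes the sums
independent of `N`. -/
theorem isNewton_sum_schur_mul [CharZero K] {h p h' p' : ℕ → K} (hp : IsNewton h p)
    (hp' : IsNewton h' p') (h1 : h 0 = 1) (h1' : h' 0 = 1) :
    IsNewton (fun n => ∑ lam ∈ partitionsOf n, schur h lam * schur h' lam)
      fun k => p k * p' k := by
  intro n
  have key := cauchy_strictMono hp hp' (le_refl n)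
  have e : ∀ m ≤ n, ∑ lam ∈ partitionsOf m, jacobiTrudi h (betaVector n lam) *
      jacobiTrudi h' (betaVector n lam) = ∑ lam ∈ partitionsOf m, schur h lam * schur h' lam := by
    intro m hm
    refine Finset.sum_congr rfl fun lam hl => ?_
    have hc := (colLen_zero_le_of_mem_partitionsOf hl).trans hm
    rw [jacobiTrudi_betaVector_of_le h1 le_rfl hc, jacobiTrudi_betaVector_of_le h1' le_rfl hc]
    rfl
  rw [sum_strictMono_eq_sum_partitionsOf (fun α => jacobiTrudi h α * jacobiTrudi h' α)
    (le_refl n), e n le_rfl] at key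
  rw [key]
  refine Finset.sum_congr rfl fun k _ => ?_
  rw [sum_strictMono_eq_sum_partitionsOf (fun α => jacobiTrudi h α * jacobiTrudi h' α)
    (Nat.sub_le n k), e _ (Nat.sub_le n k)]

theorem sum_schur_mul_zero {h h' : ℕ → K} (h1 : h 0 = 1) (h1' : h' 0 = 1) :
    ∑ lam ∈ partitionsOf 0, schur h lam * schur h' lam = 1 := by
  simp [partitionsOf_zero, schur, jacobiTrudi_betaVector_bot, h1, h1']

theorem IsNewton.congr {h p p' : ℕ → K} (hp : IsNewton h p) (hpp : ∀ k, 1 ≤ k → p k = p' k) :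
    IsNewton h p' := fun n =>
  (hp n).trans (Finset.sum_congr rfl fun k hk => by rw [hpp k (Finset.mem_Icc.1 hk).1])

theorem IsNewton.eq_of_powerSum_eq [CharZero K] {h h' p : ℕ → K} (hp : IsNewton h p)
    (hp' : IsNewton h' p) (h0 : h 0 = h' 0) (n : ℕ) : h n = h' n := by
  induction n using Nat.strong_induction_on with
  | _ n ih =>
  rcases Nat.eq_zero_or_pos n with rfl | hn
  · exact h0
  · refine mul_left_cancel₀ (a := (n : K)) (by exact_mod_cast hn.ne') ?_
    rw [hp n, hp' n]
    refine Finset.sum_congr rfl fun k hk => ?_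
    rw [Finset.mem_Icc] at hk
    rw [ih (n - k) (by omega)]

theorem IsNewton.powerSum_eq {h p p' : ℕ → K} (hp : IsNewton h p) (hp' : IsNewton h p')
    (h1 : h 0 = 1) (n : ℕ) (hn : 1 ≤ n) : p n = p' n := by
  induction n using Nat.strong_induction_on with
  | _ n ih =>
  have e := (hp n).symm.trans (hp' n)
  have hmem : n ∈ Finset.Icc 1 n := Finset.mem_Icc.2 ⟨hn, le_rfl⟩
  have hrest : ∑ k ∈ (Finset.Icc 1 n).erase n, p k * h (n - k) =
      ∑ k ∈ (Finset.Icc 1 n).erase n, p' k * h (n - k) := by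
    refine Finset.sum_congr rfl fun k hk => ?_
    rw [Finset.mem_erase, Finset.mem_Icc] at hk
    rw [ih k (by omega) hk.2.1]
  rw [← Finset.add_sum_erase _ _ hmem, ← Finset.add_sum_erase _ _ hmem, Nat.sub_self, h1,
    mul_one, mul_one, hrest] at e
  exact add_right_cancel e

/-- The exponential specialization, with generating function `e^{ct}`. It serves both the tableau
count (`c = 1`) and the Plancherel mean (`c = p 1`). -/
theorem isNewton_pow_div_factorial [CharZero K] (c : K) :
    IsNewton (fun n => c ^ n / (n ! : K)) fun k => if k = 1 then c else 0 := by
  rintro (_ | n)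
  · simp
  · rw [Finset.sum_eq_single 1]
    · have h1 : (n ! : K) ≠ 0 := by exact_mod_cast n.factorial_ne_zero
      have h2 : ((n : K) + 1) ≠ 0 := by exact_mod_cast n.succ_ne_zero
      simp only [if_pos, Nat.add_sub_cancel, Nat.factorial_succ]
      push_cast
      field_simp
      ring
    · intro k _ hk
      simp [hk]
    · simp

/-- The sequence `h` determined by Newton's identities and `h 0 = 1`. -/
noncomputable def ofPowerSums (p : ℕ → K) : ℕ → K
  | 0 => 1
  | n + 1 => ((n + 1 : ℕ) : K)⁻¹ * ∑ k : Fin (n + 1), p (k + 1) * ofPowerSums p (n - k)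
termination_by n => n
decreasing_by omega

theorem ofPowerSums_zero (p : ℕ → K) : ofPowerSums p 0 = 1 := by
  rw [ofPowerSums]

theorem sum_Icc_one_succ {M : Type*} [AddCommMonoid M] (f : ℕ → M) (n : ℕ) :
    ∑ k ∈ Finset.Icc 1 (n + 1), f k = ∑ i ∈ Finset.range (n + 1), f (i + 1) := by
  rw [← Finset.Ico_add_one_right_eq_Icc, Finset.sum_Ico_eq_sum_range]
  exact Finset.sum_congr rfl fun i _ => by rw [add_comm]

theorem isNewton_ofPowerSums [CharZero K] (p : ℕ → K) : IsNewton (ofPowerSums p) p := by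
  rintro (_ | n)
  · simp
  · rw [ofPowerSums, mul_inv_cancel_left₀ (by exact_mod_cast n.succ_ne_zero), sum_Icc_one_succ,
      Fin.sum_univ_eq_sum_range fun k => p (k + 1) * ofPowerSums p (n - k)]
    exact Finset.sum_congr rfl fun k _ => by rw [Nat.add_sub_add_right]

end Newton

/-! ### Logarithms of power series and Newton's identities -/

section Log

variable {K : Type*} [Field K] [CharZero K]

theorem derivative_logOf_mul {f : K⟦X⟧} (hf : PowerSeries.constantCoeff f = 1) :
    PowerSeries.derivative K (PowerSeries.logOf f) * f = PowerSeries.derivative K f := by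
  have hs : PowerSeries.HasSubst (f - 1) :=
    PowerSeries.HasSubst.of_constantCoeff_zero' (by simp [hf])
  have hg : PowerSeries.derivative K (PowerSeries.log K) * (1 + PowerSeries.X) = 1 := by
    rw [PowerSeries.deriv_log, mul_add, mul_one]
    ext n
    cases n with
    | zero => simp
    | succ n =>
      rw [map_add, PowerSeries.coeff_succ_mul_X, PowerSeries.coeff_mk, PowerSeries.coeff_mk,
        PowerSeries.coeff_one]
      simp [pow_succ]
  have hg' := congrArg (PowerSeries.subst (f - 1)) hg
  rw [PowerSeries.subst_mul hs, PowerSeries.subst_add hs, PowerSeries.subst_X hs,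
    ← PowerSeries.coe_substAlgHom hs, map_one, add_sub_cancel] at hg'
  rw [PowerSeries.coe_substAlgHom hs] at hg'
  rw [PowerSeries.logOf_eq, PowerSeries.derivative_subst hs, mul_right_comm, hg', one_mul,
    map_sub, Derivation.map_one_eq_zero, sub_zero]

/-- Compare coefficients in `(log f)' f = f'`. -/
theorem isNewton_coeff_logOf {f : K⟦X⟧} (hf : PowerSeries.constantCoeff f = 1) :
    IsNewton (fun n => PowerSeries.coeff n f)
      fun k => k * PowerSeries.coeff k (PowerSeries.logOf f) := by
  rintro (_ | n)
  · simp
  · have h := congrArg (PowerSeries.coeff n) (derivative_logOf_mul hf)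
    rw [PowerSeries.coeff_mul, Finset.Nat.sum_antidiagonal_eq_sum_range_succ fun i j =>
      PowerSeries.coeff i (PowerSeries.derivative K (PowerSeries.logOf f)) *
        PowerSeries.coeff j f, PowerSeries.coeff_derivative] at h
    rw [sum_Icc_one_succ, Nat.cast_succ, mul_comm, ← h]
    refine Finset.sum_congr rfl fun i _ => ?_
    rw [PowerSeries.coeff_derivative, Nat.add_sub_add_right]
    push_cast
    ring

theorem logOf_eq_of_isNewton {f L : K⟦X⟧} (hf : PowerSeries.constantCoeff f = 1)
    (hL : PowerSeries.constantCoeff L = 0)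
    (h : IsNewton (fun n => PowerSeries.coeff n f) fun k => k * PowerSeries.coeff k L) :
    PowerSeries.logOf f = L := by
  ext n
  rcases Nat.eq_zero_or_pos n with rfl | hn
  · simp [PowerSeries.constantCoeff_logOf hf, hL]
  · exact mul_left_cancel₀ (a := (n : K)) (by exact_mod_cast hn.ne')
      ((isNewton_coeff_logOf hf).powerSum_eq h (by simpa using hf) n hn)

end Log

/-! ### Wronskian Appell polynomials as quotients of Schur functions -/

section Appell

theorem constantCoeff_constEGF {A : ℕ → ℝ[X]} (hA : IsAppell A) :
    PowerSeries.constantCoeff (constEGF A) = 1 := by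
  rw [← PowerSeries.coeff_zero_eq_constantCoeff_apply, constEGF, PowerSeries.coeff_mk, hA.1]
  simp

/-- The power sums of the specialization `h k = A k (x) / k!`. -/
noncomputable def powerSum (A : ℕ → ℝ[X]) (x : ℝ) (k : ℕ) : ℝ :=
  k * PowerSeries.coeff k (PowerSeries.logOf (constEGF A)) + if k = 1 then x else 0

theorem eq_of_derivative_eq {p q : ℝ[X]} (h : derivative p = derivative q)
    (h0 : p.eval 0 = q.eval 0) : p = q := by
  have : (p - q).natDegree = 0 :=
    derivative_eq_zero.1 (by rw [derivative_sub, h, sub_self])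
  rw [← sub_eq_zero, eq_C_of_natDegree_eq_zero this, coeff_zero_eq_eval_zero, eval_sub, h0,
    sub_self, C_0]

/-- Newton's identities for `f_A(t) e^{Xt}` with `X` a variable; the term with `X` and the
derivative is the contribution of `X` to the first power sum. By induction both sides have the same
derivative, and at `0` the identity is the one for `log f_A`. -/
theorem IsAppell.natCast_mul_eq {A : ℕ → ℝ[X]} (hA : IsAppell A) (n : ℕ) :
    (n : ℝ[X]) * (C (n ! : ℝ)⁻¹ * A n) =
      ∑ k ∈ Finset.Icc 1 n, C (k * PowerSeries.coeff k (PowerSeries.logOf (constEGF A))) *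
        (C ((n - k)! : ℝ)⁻¹ * A (n - k)) + X * derivative (C (n ! : ℝ)⁻¹ * A n) := by
  have hd : ∀ m, derivative (C ((m + 1)! : ℝ)⁻¹ * A (m + 1)) = C (m ! : ℝ)⁻¹ * A m := by
    intro m
    rw [derivative_C_mul, hA.2, ← C_eq_natCast, ← mul_assoc, ← C_mul, Nat.factorial_succ]
    congr 2
    have : ((m + 1 : ℕ) : ℝ) ≠ 0 := by exact_mod_cast m.succ_ne_zero
    push_cast at this ⊢
    field_simp
  induction n with
  | zero => simp [hA.1]
  | succ n ih =>
    refine eq_of_derivative_eq ?_ ?_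
    · rw [derivative_natCast_mul, hd, derivative_add, derivative_mul (f := X), derivative_X,
        one_mul, derivative_sum, Finset.sum_Icc_succ_top (by omega), Nat.sub_self, hA.1]
      have : ∀ k ∈ Finset.Icc 1 n, derivative
          (C (k * PowerSeries.coeff k (PowerSeries.logOf (constEGF A))) *
            (C ((n + 1 - k)! : ℝ)⁻¹ * A (n + 1 - k))) =
          C (k * PowerSeries.coeff k (PowerSeries.logOf (constEGF A))) *
            (C ((n - k)! : ℝ)⁻¹ * A (n - k)) := by
        intro k hk
        rw [Finset.mem_Icc] at hk
        rw [derivative_C_mul, Nat.succ_sub hk.2, hd]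
      rw [Finset.sum_congr rfl this, eq_sub_of_add_eq ih.symm]
      simp only [mul_one, ← C_mul, derivative_C]
      push_cast
      ring
    · have h := isNewton_coeff_logOf (constantCoeff_constEGF hA) (n + 1)
      simp only [constEGF, PowerSeries.coeff_mk] at h
      simp only [eval_mul, eval_add, eval_finsetSum, eval_natCast, eval_C, eval_X, zero_mul,
        add_zero]
      rw [inv_mul_eq_div, h]
      exact Finset.sum_congr rfl fun k _ => by rw [inv_mul_eq_div]; rfl

theorem IsAppell.isNewton {A : ℕ → ℝ[X]} (hA : IsAppell A) (x : ℝ) :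
    IsNewton (fun n => (A n).eval x / (n ! : ℝ)) (powerSum A x) := by
  intro n
  have h := congrArg (eval x) (hA.natCast_mul_eq n)
  simp only [eval_mul, eval_add, eval_finsetSum, eval_natCast, eval_C, eval_X,
    inv_mul_eq_div, derivative_C_mul] at h
  rw [h]
  simp only [powerSum, add_mul, Finset.sum_add_distrib, ite_mul, zero_mul, Finset.sum_ite_eq',
    Finset.mem_Icc, le_refl, true_and]
  congr 1
  rcases n with _ | n
  · simp [hA.1]
  · rw [if_pos (by omega), hA.2, Nat.factorial_succ, Nat.add_sub_cancel, eval_mul, eval_natCast]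
    have : ((n + 1 : ℕ) : ℝ) ≠ 0 := by exact_mod_cast n.succ_ne_zero
    push_cast at this ⊢
    field_simp

theorem IsAppell.eval_iterate_derivative {A : ℕ → ℝ[X]} (hA : IsAppell A) (x : ℝ) (i m : ℕ) :
    (derivative^[i] (A m)).eval x =
      m ! * extendZero (fun n => (A n).eval x / (n ! : ℝ)) (m - i : ℤ) := by
  induction i generalizing m with
  | zero =>
    have : (m ! : ℝ) ≠ 0 := by exact_mod_cast m.factorial_ne_zero
    rw [Nat.cast_zero, sub_zero, extendZero_natCast, Function.iterate_zero, id]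
    field_simp
  | succ i ih =>
    rw [Function.iterate_succ_apply]
    rcases m with _ | m
    · rw [hA.1, derivative_one, iterate_map_zero, extendZero_of_neg _ (by push_cast; omega)]
      simp
    · rw [hA.2, iterate_derivative_natCast_mul, eval_mul, ih, eval_natCast, Nat.factorial_succ]
      push_cast
      rw [add_sub_add_right_eq_sub]
      ring

theorem betaVector_colLen_eq (lam : YoungDiagram) (j : Fin (lam.colLen 0)) :
    betaVector (lam.colLen 0) lam j = (degreeVector lam j : ℤ) := by
  simp [betaVector, degreeVector]

theorem IsAppell.eval_wronskianDet {A : ℕ → ℝ[X]} (hA : IsAppell A) (x : ℝ) (lam : YoungDiagram) :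
    (wronskianDet fun i => A (degreeVector lam i)).eval x =
      (∏ j, ((degreeVector lam j)! : ℝ)) * schur (fun n => (A n).eval x / (n ! : ℝ)) lam := by
  rw [wronskianDet, ← coe_evalRingHom, RingHom.map_det, schur, jacobiTrudi, ← Matrix.det_mul_row]
  congr 1
  ext i j
  simp only [RingHom.mapMatrix_apply, Matrix.map_apply, Matrix.of_apply, coe_evalRingHom,
    hA.eval_iterate_derivative, betaVector_colLen_eq]

/-- Falling factorials are monic, so they may replace the monomials in the Vandermonde determinant;
moreover `m (m-1) ⋯ (m-i+1) = m!/(m-i)!`. The column factors `m!` are those of the Wronskian and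
cancel in the quotient. -/
theorem det_vandermonde_degreeVector (lam : YoungDiagram) :
    (Matrix.vandermonde fun i => (degreeVector lam i : ℝ)).det =
      (∏ j, ((degreeVector lam j)! : ℝ)) * schur (fun n => 1 / (n ! : ℝ)) lam := by
  rw [Matrix.det_eval_matrixOfPolynomials_eq_det_vandermonde _
    (fun i : Fin (lam.colLen 0) => descPochhammer ℝ i)
    (fun i => descPochhammer_natDegree ℝ i) (fun i => monic_descPochhammer ℝ i),
    ← Matrix.det_transpose, schur, jacobiTrudi, ← Matrix.det_mul_row]
  congr 1
  ext i j
  simp only [Matrix.transpose_apply, Matrix.of_apply, betaVector_colLen_eq,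
    descPochhammer_eval_eq_descFactorial]
  set m := degreeVector lam j
  rcases le_or_gt (i : ℕ) m with h | h
  · rw [← Nat.cast_sub h, extendZero_natCast, ← Nat.factorial_mul_descFactorial h]
    have : ((m - i)! : ℝ) ≠ 0 := by exact_mod_cast (m - i).factorial_ne_zero
    push_cast
    field_simp
  · rw [extendZero_of_neg _ (by omega), Nat.descFactorial_of_lt h]
    simp

theorem det_vandermonde_degreeVector_ne_zero (lam : YoungDiagram) :
    (Matrix.vandermonde fun i => (degreeVector lam i : ℝ)).det ≠ 0 := by
  rw [Matrix.det_vandermonde_ne_zero_iff]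
  intro a b hab
  refine (betaVector_strictMono lam).injective ?_
  rw [betaVector_colLen_eq, betaVector_colLen_eq, Nat.cast_inj]
  exact Nat.cast_injective hab

theorem schur_inv_factorial_ne_zero (lam : YoungDiagram) :
    schur (fun n => 1 / (n ! : ℝ)) lam ≠ 0 := by
  have h := det_vandermonde_degreeVector_ne_zero lam
  rw [det_vandermonde_degreeVector] at h
  exact right_ne_zero_of_mul h

theorem IsAppell.eval_wronskianAppell {A : ℕ → ℝ[X]} (hA : IsAppell A) (x : ℝ)
    (lam : YoungDiagram) :
    (wronskianAppell A lam).eval x =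
      schur (fun n => (A n).eval x / (n ! : ℝ)) lam / schur (fun n => 1 / (n ! : ℝ)) lam := by
  have h := det_vandermonde_degreeVector_ne_zero lam
  rw [wronskianAppell, eval_mul, eval_C, hA.eval_wronskianDet, det_vandermonde_degreeVector] at *
  have h1 := left_ne_zero_of_mul h
  have h2 := right_ne_zero_of_mul h
  field_simp

/-! ### Plancherel moments -/

theorem isNewton_inv_factorial :
    IsNewton (fun n => 1 / (n ! : ℝ)) fun k => if k = 1 then 1 else 0 := by
  simpa using isNewton_pow_div_factorial (1 : ℝ)

/-- The hook length formula in Frobenius' determinantal form. -/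
theorem numSYT_eq_schur {lam : YoungDiagram} {n : ℕ} (h : lam ∈ partitionsOf n) :
    (numSYT lam : ℝ) = n ! * schur (fun n => 1 / (n ! : ℝ)) lam := by
  have hn := mem_partitionsOf.1 h
  rw [numSYT_eq (by simp) isNewton_inv_factorial le_rfl, hn,
    jacobiTrudi_betaVector_of_le (by simp) le_rfl (hn ▸ colLen_zero_le_card lam)]
  rfl

theorem plancherelExp_eq (n : ℕ) (Y : YoungDiagram → ℝ) :
    plancherelExp n Y =
      n ! * ∑ lam ∈ partitionsOf n, schur (fun n => 1 / (n ! : ℝ)) lam ^ 2 * Y lam := by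
  rw [plancherelExp, Finset.mul_sum]
  refine Finset.sum_congr rfl fun lam hl => ?_
  have : (n ! : ℝ) ≠ 0 := by exact_mod_cast n.factorial_ne_zero
  rw [numSYT_eq_schur hl]
  field_simp

/-- One factor of the squared weight cancels the denominator. The Cauchy identity then pairs `h`
with the exponential specialization, which retains only `p 1`. -/
theorem plancherelExp_schur_div {h p : ℕ → ℝ} (hp : IsNewton h p) (h1 : h 0 = 1) (n : ℕ) :
    plancherelExp n (fun lam => schur h lam / schur (fun n => 1 / (n ! : ℝ)) lam) = p 1 ^ n := by
  have hZ := isNewton_sum_schur_mul isNewton_inv_factorial hp (by simp) h1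
  have hZ' := hZ.congr (p' := fun k => if k = 1 then p 1 else 0) (fun k _ => by
    by_cases hk : k = 1 <;> simp [hk])
  have := hZ'.eq_of_powerSum_eq (isNewton_pow_div_factorial (p 1))
    (by rw [sum_schur_mul_zero (by simp) h1]; simp) n
  rw [plancherelExp_eq]
  have hn : (n ! : ℝ) ≠ 0 := by exact_mod_cast n.factorial_ne_zero
  rw [eq_div_iff hn, mul_comm] at this
  rw [← this]
  congr 1
  refine Finset.sum_congr rfl fun lam _ => ?_
  have := schur_inv_factorial_ne_zero lam
  field_simp

/-- The total mass is the preceding mean for `h n = 1/n!`, where the quotient is identically one. -/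
theorem plancherelExp_one (n : ℕ) : plancherelExp n (fun _ => 1) = 1 := by
  have h := plancherelExp_schur_div isNewton_inv_factorial (by simp) n
  simp only [div_self (schur_inv_factorial_ne_zero _), if_true, one_pow] at h
  exact h

theorem plancherelExp_schur_div_sq (h : ℕ → ℝ) (n : ℕ) :
    plancherelExp n (fun lam => (schur h lam / schur (fun n => 1 / (n ! : ℝ)) lam) ^ 2) =
      n ! * ∑ lam ∈ partitionsOf n, schur h lam * schur h lam := by
  rw [plancherelExp_eq]
  congr 1
  refine Finset.sum_congr rfl fun lam _ => ?_
  have := schur_inv_factorial_ne_zero lam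
  field_simp

theorem plancherelVar_eq (n : ℕ) (Y : YoungDiagram → ℝ) :
    plancherelVar n Y = plancherelExp n (fun lam => Y lam ^ 2) - plancherelExp n Y ^ 2 := by
  set E := plancherelExp n Y with hE
  have h1 := plancherelExp_one n
  unfold plancherelVar
  rw [← hE]
  unfold plancherelExp at *
  have e : ∀ lam, (numSYT lam : ℝ) ^ 2 / (n ! : ℝ) * (Y lam - E) ^ 2 =
      (numSYT lam : ℝ) ^ 2 / (n ! : ℝ) * Y lam ^ 2 -
        2 * E * ((numSYT lam : ℝ) ^ 2 / (n ! : ℝ) * Y lam) +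
        E ^ 2 * ((numSYT lam : ℝ) ^ 2 / (n ! : ℝ) * 1) := fun lam => by ring
  rw [Finset.sum_congr rfl fun lam _ => e lam, Finset.sum_add_distrib, Finset.sum_sub_distrib,
    ← Finset.mul_sum, ← Finset.mul_sum, h1, ← hE]
  ring

/-! ### The sequence `B` and the growth of the variance -/

/-- The Appell sequence with `A n (0) = n! * g n`. -/
noncomputable def appellOf (g : ℕ → ℝ) (n : ℕ) : ℝ[X] :=
  ∑ k ∈ Finset.range (n + 1), C ((n ! : ℝ) / (k ! : ℝ) * g (n - k)) * X ^ k

theorem isAppell_appellOf {g : ℕ → ℝ} (hg : g 0 = 1) : IsAppell (appellOf g) := by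
  refine ⟨by simp [appellOf, hg], fun n => ?_⟩
  rw [appellOf, Finset.sum_range_succ', derivative_add, derivative_sum, pow_zero, mul_one,
    derivative_C, add_zero, appellOf, Finset.mul_sum]
  refine Finset.sum_congr rfl fun k _ => ?_
  rw [derivative_C_mul_X_pow, Nat.add_sub_add_right, Nat.add_sub_cancel, ← C_eq_natCast,
    ← mul_assoc, ← C_mul]
  congr 2
  have h1 : (k ! : ℝ) ≠ 0 := by exact_mod_cast k.factorial_ne_zero
  have h2 : (k : ℝ) + 1 ≠ 0 := by exact_mod_cast k.succ_ne_zero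
  rw [Nat.factorial_succ, Nat.factorial_succ]
  push_cast
  field_simp

theorem eval_zero_appellOf (g : ℕ → ℝ) (n : ℕ) : (appellOf g n).eval 0 = n ! * g n := by
  rw [appellOf, Finset.sum_range_succ', eval_add, eval_finsetSum, Finset.sum_eq_zero]
  · simp
  · intro k _
    simp

theorem constEGF_appellOf (g : ℕ → ℝ) : constEGF (appellOf g) = PowerSeries.mk g := by
  ext n
  rw [constEGF, PowerSeries.coeff_mk, PowerSeries.coeff_mk, eval_zero_appellOf,
    mul_div_cancel_left₀]
  exact_mod_cast n.factorial_ne_zero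

/-- The coefficient of `y ^ (n - 1)` is a multiple of `g 1`, so centrality lowers the degree of the
difference to at most `n - 2`. -/
theorem eval_appellOf_sub_pow {g : ℕ → ℝ} (h0 : g 0 = 1) (h1 : g 1 = 0) {n : ℕ} (hn : 2 ≤ n)
    (y : ℝ) : (appellOf g n).eval y - y ^ n =
      ∑ k ∈ Finset.range (n - 1), (n ! : ℝ) / (k ! : ℝ) * g (n - k) * y ^ k := by
  obtain ⟨m, rfl⟩ : ∃ m, n = m + 1 := ⟨n - 1, by omega⟩
  have : ((m + 1)! : ℝ) ≠ 0 := by exact_mod_cast (m + 1).factorial_ne_zero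
  rw [appellOf, eval_finsetSum, Finset.sum_range_succ, Finset.sum_range_succ]
  simp [h0, h1, this]

open Asymptotics Bornology in
theorem sum_mul_sq_pow_isBigO (b : ℕ → ℝ) (c : ℝ) {n : ℕ} (hn : 2 ≤ n) :
    (fun x : ℝ => ∑ k ∈ Finset.range (n - 1), b k * ((x + c) ^ 2) ^ k) =O[cobounded ℝ]
      fun x : ℝ => x ^ (2 * n - 4) := by
  refine IsBigO.fun_sum fun k hk => ?_
  rw [Finset.mem_range] at hk
  have h1 : (fun x : ℝ => x + c) =O[cobounded ℝ] fun x : ℝ => x :=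
    (isBigO_refl _ _).add (isLittleO_const_id_cobounded c).isBigO
  have h2 : (fun x : ℝ => x ^ (2 * k)) =O[cobounded ℝ] fun x : ℝ => x ^ (2 * n - 4) := by
    refine IsBigO.of_bound 1 ?_
    filter_upwards [(tendsto_norm_cobounded_atTop (E := ℝ)).eventually_ge_atTop (1 : ℝ)] with x hx
    rw [one_mul, norm_pow, norm_pow]
    exact pow_le_pow_right₀ hx (by omega)
  simp_rw [← pow_mul]
  exact ((h1.pow (2 * k)).trans h2).const_mul_left (b k)

end Appell

end WronskianAppell

theorem corollary5 (A : ℕ → Polynomial ℝ) (hA : WronskianAppell.IsAppell A) :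
    ∃ B : ℕ → Polynomial ℝ,
      WronskianAppell.IsAppell B ∧ (B 1).eval 0 = 0 ∧
      PowerSeries.logOf (WronskianAppell.constEGF B) =
        PowerSeries.mk (fun k : ℕ =>
          if 2 ≤ k then
            (WronskianAppell.cumulant A k) ^ 2 / (Nat.factorial (k - 1) : ℝ)
              * (1 / (Nat.factorial k : ℝ))
          else 0) ∧
      ∀ n : ℕ, 2 ≤ n →
        (∀ x : ℝ,
          WronskianAppell.plancherelVar n
              (fun lam => (WronskianAppell.wronskianAppell A lam).eval x) =
            WronskianAppell.plancherelExp n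
                (fun lam => ((WronskianAppell.wronskianAppell A lam).eval x) ^ 2) -
              (WronskianAppell.plancherelExp n
                (fun lam => (WronskianAppell.wronskianAppell A lam).eval x)) ^ 2) ∧
        (∀ x : ℝ,
          WronskianAppell.plancherelVar n
              (fun lam => (WronskianAppell.wronskianAppell A lam).eval x) =
            (B n).eval ((x + WronskianAppell.cumulant A 1) ^ 2) -
              (x + WronskianAppell.cumulant A 1) ^ (2 * n)) ∧
        (fun x : ℝ => WronskianAppell.plancherelVar n
              (fun lam => (WronskianAppell.wronskianAppell A lam).eval x))
          =O[Bornology.cobounded ℝ] (fun x : ℝ => x ^ (2 * n - 4)) := by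
  open WronskianAppell in
  set d : ℕ → ℝ := fun k =>
    if 2 ≤ k then cumulant A k ^ 2 / (Nat.factorial (k - 1) : ℝ) * (1 / (Nat.factorial k : ℝ))
    else 0 with hd
  -- The factor `k` converts the prescribed logarithmic coefficients `d k` of `B` into power sums.
  set g : ℕ → ℝ := ofPowerSums fun k => k * d k with hg
  have hN : IsNewton g fun k => k * d k := isNewton_ofPowerSums _
  have hg0 : g 0 = 1 := ofPowerSums_zero _
  have hg1 : g 1 = 0 := by simpa [hd] using hN 1
  have hB := isAppell_appellOf hg0
  have hlog : PowerSeries.logOf (constEGF (appellOf g)) = PowerSeries.mk d := by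
    refine logOf_eq_of_isNewton (constantCoeff_constEGF hB) (by simp [hd]) ?_
    simpa only [constEGF_appellOf, PowerSeries.coeff_mk] using hN
  -- For `k ≥ 2` both sides are `(c_k/(k-1)!)²`. For `k = 1` the left side is `(x + c_1)²`, and
  -- since `d 1 = 0` this is exactly the argument at which `B` is evaluated.
  have hsq : ∀ x k, 1 ≤ k → powerSum A x k * powerSum A x k =
      powerSum (appellOf g) ((x + cumulant A 1) ^ 2) k := by
    intro x k hk
    simp only [powerSum, hlog, PowerSeries.coeff_mk, hd]
    rcases hk.eq_or_lt with rfl | hk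
    · simp [cumulant]
      ring
    · obtain ⟨m, rfl⟩ : ∃ m, k = m + 1 := ⟨k - 1, by omega⟩
      rw [if_neg (by omega), if_pos (by omega), if_neg (by omega), cumulant, Nat.add_sub_cancel,
        Nat.factorial_succ]
      have h1 : (Nat.factorial m : ℝ) ≠ 0 := by exact_mod_cast m.factorial_ne_zero
      have h2 : (m : ℝ) + 1 ≠ 0 := by exact_mod_cast m.succ_ne_zero
      push_cast
      field_simp
      ring
  have hA0 : ∀ x, (A 0).eval x / (Nat.factorial 0 : ℝ) = 1 := by simp [hA.1]
  have hvar : ∀ n x, plancherelVar n (fun lam => (wronskianAppell A lam).eval x) =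
      (appellOf g n).eval ((x + cumulant A 1) ^ 2) - (x + cumulant A 1) ^ (2 * n) := by
    intro n x
    have hn : (Nat.factorial n : ℝ) ≠ 0 := by exact_mod_cast n.factorial_ne_zero
    have hx := hA.isNewton x
    have hZ := (isNewton_sum_schur_mul hx hx (hA0 x) (hA0 x)).congr (hsq x)
    have hZn := hZ.eq_of_powerSum_eq (hB.isNewton ((x + cumulant A 1) ^ 2))
      (by rw [sum_schur_mul_zero (hA0 x) (hA0 x), hB.1]; simp) n
    rw [eq_div_iff hn, mul_comm] at hZn
    have hp1 : powerSum A x 1 = x + cumulant A 1 := by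
      simp [powerSum, cumulant, add_comm]
    rw [plancherelVar_eq]
    simp_rw [hA.eval_wronskianAppell]
    rw [plancherelExp_schur_div_sq, plancherelExp_schur_div hx (hA0 x), hZn, hp1, ← pow_mul,
      mul_comm n 2]
  refine ⟨appellOf g, hB, by rw [eval_zero_appellOf, hg1, mul_zero], hlog, fun n hn =>
    ⟨fun x => plancherelVar_eq n _, hvar n, ?_⟩⟩
  simp_rw [hvar n, pow_mul, eval_appellOf_sub_pow hg0 hg1 hn]
  exact sum_mul_sq_pow_isBigO _ _ hn
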